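/- Let $\rho,\phi\in C_0^\infty(\mathbb R)$ be real-valued with $\operatorname{supp}\rho,\operatorname{supp}\phi\subset\{t:\tfrac14<|t|<4\}$ and, writing $\rho_j(t):=2^j\rho(2^jt)$, $$\frac1t=\sum_{j\in\mathbb Z}\rho_j(t),\qquad 1=\sum_{j\in\mathbb Z}\phi(2^jt)\qquad\text{for all }t\in\mathbb R\setminus\{0\}.$$ Let $d\in\mathbb N$, let $\alpha_1,\dots,\alpha_d\in(0,\infty)\setminus\{1,2\}$ be pairwise distinct, let $a_0,a_1,\dots,a_d:\mathbb R\to\mathbb R$ be arbitrary measurable functions, and put $$\gamma(x,t):=a_0(x)\,t+\sum_{k=1}^d a_k(x)\,t^{\alpha_k},$$ where for $t<0$ each power $t^{\alpha_k}$ is read as either $|t|^{\alpha_k}$ or $-|t|^{\alpha_k}$ (any fixed choice of sign for each $k$). For $j\in\mathbb Z$ and $m\in\mathbb N$ define the piece of the $\gamma$-Carleson operator $C_\gamma f(x)=\int_{\mathbb R}f(x-t)\,e^{i\gamma(x,t)}\,\frac{dt}{t}$ by $$C_{j,m}f(x):=\left(\int_{\mathbb R}f(x-t)\,e^{i\gamma(x,t)}\,\rho_j(t)\,dt\right)\phi\!\left(\frac{\sum_{k=1}^d|a_k(x)|\,2^{-j\alpha_k}}{2^m}\right).$$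 Then there exist $\varepsilon>0$ depending only on $d$, and $K>0$ depending only on $d,\alpha_1,\dots,\alpha_d,\rho,\phi$ and the choice of signs (in particular not on $j$, $m$, $f$ or the functions $a_0,\dots,a_d$), such that for all $j\in\mathbb Z$, all $m\in\mathbb N$ and all $f\in L^2(\mathbb R)$ the integral defining $C_{j,m}f(x)$ converges absolutely for every $x\in\mathbb R$, $C_{j,m}f\in L^2(\mathbb R)$, and $$\|C_{j,m}f\|_{L^2(\mathbb R)}\le K\,2^{-\varepsilon m}\,\|f\|_{L^2(\mathbb R)}.$$ -/

import Mathlib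

open MeasureTheory
open scoped ContDiff

/-- The real power `t ^ α` for `t` of either sign: it is `|t| ^ α` for `t ≥ 0` and `s * |t| ^ α`
for `t < 0`. The choice `s = 1` reads `t ^ α` as `|t| ^ α`, the choice `s = -1` reads it as
`sgn t * |t| ^ α`. For a natural number `α` the ordinary power is obtained with `s = (-1) ^ α`. -/
noncomputable def branchPow (s α t : ℝ) : ℝ :=
  if 0 ≤ t then |t| ^ α else s * |t| ^ α

/-- The variable planar curve `γ(x,t) = a₀(x) t + ∑_{k=1}^d a_k(x) t^{α_k}`. -/
noncomputable def hybridCurve {d : ℕ} (α s : Fin d → ℝ) (a₀ : ℝ → ℝ) (a : Fin d → ℝ → ℝ)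
    (x t : ℝ) : ℝ :=
  a₀ x * t + ∑ k, a k x * branchPow (s k) (α k) t

/-- The size `∑_{k=1}^d |a_k(x)| 2^{-j α_k}` of the nonlinear part of the curve at scale `2^{-j}`. -/
noncomputable def nonlinearSize {d : ℕ} (α : Fin d → ℝ) (a : Fin d → ℝ → ℝ) (j : ℤ) (x : ℝ) : ℝ :=
  ∑ k, |a k x| * (2 : ℝ) ^ (-(j : ℝ) * α k)

/-- The dilated kernel `ρ_j(t) = 2^j ρ(2^j t)`. -/
noncomputable def dyadicDilate (ρ : ℝ → ℝ) (j : ℤ) (t : ℝ) : ℝ :=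
  (2 : ℝ) ^ j * ρ ((2 : ℝ) ^ j * t)

/-- `ρ` is smooth, supported in `1/4 < |t| < 4`, and `1/t = ∑_{j ∈ ℤ} ρ_j(t)` for `t ≠ 0`. -/
structure IsDyadicKernel (ρ : ℝ → ℝ) : Prop where
  smooth : ContDiff ℝ ∞ ρ
  supp : tsupport ρ ⊆ {t : ℝ | 1 / 4 < |t| ∧ |t| < 4}
  sum_eq : ∀ t : ℝ, t ≠ 0 → HasSum (fun j : ℤ => dyadicDilate ρ j t) (1 / t)

/-- `φ` is smooth, supported in `1/4 < |t| < 4`, and `1 = ∑_{j ∈ ℤ} φ(2^j t)` for `t ≠ 0`. -/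
structure IsDyadicCutoff (φ : ℝ → ℝ) : Prop where
  smooth : ContDiff ℝ ∞ φ
  supp : tsupport φ ⊆ {t : ℝ | 1 / 4 < |t| ∧ |t| < 4}
  sum_eq : ∀ t : ℝ, t ≠ 0 → HasSum (fun j : ℤ => φ ((2 : ℝ) ^ j * t)) 1

/-- The integrand `f(x-t) e^{i γ(x,t)} ρ_j(t)` of the piece at scale `j`. -/
noncomputable def carlesonIntegrand (ρ : ℝ → ℝ) (γ : ℝ → ℝ → ℝ) (j : ℤ) (f : ℝ → ℂ)
    (x t : ℝ) : ℂ :=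
  f (x - t) * Complex.exp (Complex.I * (γ x t : ℂ)) * (dyadicDilate ρ j t : ℂ)

/-- The piece `C_{j,m}` of the Carleson operator along the curve `hybridCurve α s a₀ a`. -/
noncomputable def carlesonPiece (ρ φ : ℝ → ℝ) {d : ℕ} (α s : Fin d → ℝ) (a₀ : ℝ → ℝ)
    (a : Fin d → ℝ → ℝ) (j : ℤ) (m : ℕ) (f : ℝ → ℂ) (x : ℝ) : ℂ :=
  (∫ t : ℝ, carlesonIntegrand ρ (hybridCurve α s a₀ a) j f x t) *
    (φ (nonlinearSize α a j x / 2 ^ m) : ℂ)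

/-!
The proof is the `TT*` method: after a split of `ρ` by the sign of `t` and a rescaling to unit
scale, it suffices to bound `∫ |K(x, y)| dy` uniformly in `x` by a negative power of `2 ^ m`, where
`K` is the kernel of `TT*` (`memLp_integral_kernel`). With `s = x - y` this kernel is an
oscillatory integral in `t` whose phase is the curve of `x` at `t` minus the curve of `y` at
`t - s`.

Two derivatives remove the arbitrary linear terms `a₀`. What is left is, up to the factor `2 ^ m`,
a difference `A t - B (t - s)`, where `A` and `B` are generalized polynomials with the nonzero
exponents `β k = α k - 2`; the coefficients of `A` have size comparable to `1` because
`α k (α k - 1) ≠ 0`, and nothing is known about `B` apart from an upper bound. By the second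
derivative test of van der Corput the oscillatory integral is controlled by the measure of the set
of `t` for which this difference is small (`norm_integral_exp_le_volume_sublevel`).

The unknown `B` is eliminated as follows. Write
`∏ k, (X - β k) = ∑ j, c j * X (X - 1) ⋯ (X - j + 1)`. The Euler operator
`∑ j, c j * u ^ j * (d/du) ^ j` annihilates every power `u ^ β k`. Applied with `u = t - s` to the
difference it kills `B` and leaves `h(t, u) = ∑ j, c j * u ^ j * A⁽ʲ⁾(t)`. Hence wherever `h` is
not small, some derivative of the difference of order at most `d` is not small, and a sublevel set
estimate applies (`exists_volume_sub_sublevel_le`, by way of `volume_sublevel_le`).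

It remains to see that `h` is small only on a small set of pairs `(s, t)`, which no longer involves
`y` (`exists_lintegral_volume_euler_sublevel_le`). For fixed `t` it is a polynomial in `u` of
degree at most `d` with constant coefficient `c 0 * A t`, and `c 0 = ∏ k, (-β k) ≠ 0` since no
exponent `α k` equals `2`. So it suffices that `A` is small only on a small set of `t`. This holds
since at each point some derivative of `A` of order at most `d` is bounded below: the Euler
operator that annihilates all powers but one recovers each coefficient
(`exists_sum_abs_le_of_genPoly_le`), and the exponents are distinct. All losses are powers with
exponents that depend only on `d`, and so does the final gain.
-/

/-! ### Sublevel sets of functions with a large derivative -/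

/-- An estimate `F ≤ G + κ` on all short intervals, with `F` subadditive and `G` superadditive
under concatenation of intervals, sums up to an estimate on a long interval. -/
lemma le_add_mul_of_short_intervals {F G : ℝ → ℝ → ℝ} {r κ a b : ℝ} (hr : 0 < r) (hκ : 0 ≤ κ)
    (hab : a ≤ b)
    (hF : ∀ x y z, a ≤ x → x ≤ y → y ≤ z → z ≤ b → F x z ≤ F x y + F y z)
    (hG : ∀ x y z, a ≤ x → x ≤ y → y ≤ z → z ≤ b → G x y + G y z ≤ G x z)
    (h : ∀ x y, a ≤ x → x ≤ y → y ≤ b → y - x ≤ r → F x y ≤ G x y + κ) :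
    F a b ≤ G a b + ((b - a) / r + 1) * κ := by
  have key : ∀ n : ℕ, ∀ c, a ≤ c → c ≤ b → c - a ≤ (n + 1) * r →
      F a c ≤ G a c + (n + 1) * κ := by
    intro n
    induction n with
    | zero =>
      intro c hac hcb hc
      simpa using h a c le_rfl hac hcb (by simpa using hc)
    | succ n ih =>
      intro c hac hcb hc
      push_cast at hc ⊢
      have h1 : a ≤ max a (c - r) := le_max_left _ _
      have h2 : max a (c - r) ≤ c := max_le hac (by linarith)
      have h3 : c - max a (c - r) ≤ r := by linarith [le_max_right a (c - r)]
      have h4 : max a (c - r) - a ≤ (n + 1) * r := by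
        rcases max_cases a (c - r) with ⟨h, _⟩ | ⟨h, _⟩
        · rw [h]; simp; positivity
        · rw [h]; linarith
      have := ih _ h1 (h2.trans hcb) h4
      have := h _ c h1 h2 hcb h3
      have := hF _ _ _ le_rfl h1 h2 hcb
      have := hG _ _ _ le_rfl h1 h2 hcb
      linarith
  have hq : 0 ≤ (b - a) / r := div_nonneg (by linarith) hr.le
  have h1 := key ⌊(b - a) / r⌋₊ b hab le_rfl (by
    have := (Nat.lt_floor_add_one ((b - a) / r)).le
    rwa [div_le_iff₀ hr] at this)
  have h2 := Nat.floor_le hq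
  nlinarith

/-- A set of reals of large measure contains many well separated points. -/
lemma exists_spaced_points {τ : ℝ} (hτ : 0 < τ) : ∀ (n : ℕ) (E : Set ℝ), BddBelow E →
    ENNReal.ofReal (2 * n * τ) < volume E →
    ∃ p : ℕ → ℝ, (∀ i ≤ n, p i ∈ E) ∧ ∀ i < n, p i + τ ≤ p (i + 1) := by
  intro n
  induction n with
  | zero =>
    intro E _ hE
    obtain ⟨x, hx⟩ : E.Nonempty := nonempty_of_measure_ne_zero (pos_of_gt hE).ne'
    exact ⟨fun _ => x, fun i _ => hx, fun i hi => by omega⟩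
  | succ n ih =>
    intro E hb hE
    have hne : E.Nonempty := nonempty_of_measure_ne_zero (pos_of_gt hE).ne'
    obtain ⟨x, hx, hxlt⟩ := Real.lt_sInf_add_pos hne hτ
    have hsub : E ⊆ Set.Icc (sInf E) (sInf E + 2 * τ) ∪ (E ∩ Set.Ici (x + τ)) := by
      intro y hy
      by_cases h : x + τ ≤ y
      · exact Or.inr ⟨hy, h⟩
      · exact Or.inl ⟨csInf_le hb hy, by linarith⟩
    have hvol : volume E ≤ ENNReal.ofReal (2 * τ) + volume (E ∩ Set.Ici (x + τ)) := by
      refine (measure_mono hsub).trans ((measure_union_le _ _).trans ?_)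
      rw [Real.volume_Icc]
      simp
    obtain ⟨p, hp, hs⟩ := ih (E ∩ Set.Ici (x + τ)) (hb.mono Set.inter_subset_left) (by
      by_contra hcon
      rw [not_lt] at hcon
      have := hE.trans_le (hvol.trans (add_le_add_right hcon _))
      rw [← ENNReal.ofReal_add (by positivity) (by positivity)] at this
      refine lt_irrefl _ (this.trans_le (ENNReal.ofReal_le_ofReal ?_))
      push_cast
      linarith)
    refine ⟨fun i => if i = 0 then x else p (i - 1), fun i hi => ?_, fun i hi => ?_⟩
    · rcases i with _ | i
      · simpa using hx
      · simpa using (hp i (by omega)).1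
    · rcases i with _ | i
      · simpa using (hp 0 (by omega)).2
      · simpa using hs i (by omega)

/-- Between two neighbouring points where `F 0` is small its derivative is small somewhere. Every
second gap keeps the spacing, so after `l` steps a `2 ^ l`-th part of the points is left. -/
lemma exists_derivs_small_of_spaced {x y τ : ℝ} (hτ : 0 < τ) :
    ∀ (l : ℕ) (F : ℕ → ℝ → ℝ) (μ : ℝ) (n : ℕ), 2 ^ l ≤ n + 1 →
    (∀ i < l, ∀ t ∈ Set.Icc x y, HasDerivAt (F i) (F (i + 1) t) t) →
    (∃ p : ℕ → ℝ, (∀ i ≤ n, p i ∈ Set.Icc x y ∧ |F 0 (p i)| ≤ μ) ∧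
      ∀ i < n, p i + τ ≤ p (i + 1)) →
    ∃ t ∈ Set.Icc x y, |F l t| ≤ (2 / τ) ^ l * μ := by
  intro l
  induction l with
  | zero =>
    rintro F μ n - - ⟨p, hp, -⟩
    exact ⟨p 0, (hp 0 (by omega)).1, by simpa using (hp 0 (by omega)).2⟩
  | succ l ih =>
    rintro F μ n hn hF ⟨p, hp, hs⟩
    have hl : 1 ≤ 2 ^ l := Nat.one_le_two_pow
    rw [pow_succ] at hn
    have hstep : ∀ i : ℕ, ∃ q, i ≤ 2 ^ l - 1 →
        q ∈ Set.Ioo (p (2 * i)) (p (2 * i + 1)) ∧ |F 1 q| ≤ 2 / τ * μ := by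
      intro i
      by_cases hi : i ≤ 2 ^ l - 1
      · have h0 := hp (2 * i) (by omega)
        have h1 := hp (2 * i + 1) (by omega)
        have h2 := hs (2 * i) (by omega)
        obtain ⟨q, hq, hq'⟩ := exists_hasDerivAt_eq_slope (F 0) (F 1)
          (show p (2 * i) < p (2 * i + 1) by linarith)
          (fun t ht => (hF 0 (by omega) t ⟨h0.1.1.trans ht.1,
            ht.2.trans h1.1.2⟩).continuousAt.continuousWithinAt)
          (fun t ht => hF 0 (by omega) t ⟨h0.1.1.trans ht.1.le, ht.2.le.trans h1.1.2⟩)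
        refine ⟨q, fun _ => ⟨hq, ?_⟩⟩
        have hpos : 0 < p (2 * i + 1) - p (2 * i) := by linarith
        have hμ : 0 ≤ μ := (abs_nonneg _).trans h0.2
        rw [hq', abs_div, abs_of_pos hpos, div_mul_eq_mul_div]
        refine div_le_div₀ (by positivity) ?_ hτ (by linarith)
        refine (abs_sub _ _).trans ?_
        linarith [h0.2, h1.2]
      · exact ⟨0, fun h => absurd h hi⟩
    choose q hq using hstep
    obtain ⟨t, ht, h⟩ := ih (fun i => F (i + 1)) (2 / τ * μ) (2 ^ l - 1) (by omega)
      (fun i hi => hF (i + 1) (by omega))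
      ⟨q, fun i hi => ⟨⟨(hp (2 * i) (by omega)).1.1.trans (hq i hi).1.1.le,
        (hq i hi).1.2.le.trans (hp (2 * i + 1) (by omega)).1.2⟩, (hq i hi).2⟩,
        fun i hi => by
          have h1 := (hq i (by omega)).1.2
          have h2 := (hq (i + 1) (by omega)).1.1
          have h3 := hs (2 * i + 1) (by omega)
          have h4 : 2 * (i + 1) = 2 * i + 1 + 1 := by ring
          rw [h4] at h2
          linarith⟩
    exact ⟨t, ht, h.trans_eq (by ring)⟩

/-- If some derivative of order at most `k` is large at one point of a short interval, then the
function can be small only on a small part of that interval. -/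
lemma volume_sublevel_le {F : ℕ → ℝ → ℝ} {k : ℕ} {x y τ μ M : ℝ} (hτ : 0 < τ) (hτ2 : τ ≤ 2)
    (hμ : 0 ≤ μ)
    (hF : ∀ i ≤ k, ∀ t ∈ Set.Icc x y, HasDerivAt (F i) (F (i + 1) t) t)
    (hM : ∀ i ≤ k, ∀ t ∈ Set.Icc x y, |F (i + 1) t| ≤ M)
    (hbig : ∃ t ∈ Set.Icc x y, ∃ l ≤ k, (2 / τ) ^ k * μ + M * (y - x) < |F l t|) :
    volume.real ({t | |F 0 t| ≤ μ} ∩ Set.Ioc x y) ≤ 2 * 2 ^ k * τ := by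
  by_contra! hcon
  obtain ⟨t, ht, l, hl, hlt⟩ := hbig
  have hfin : volume ({t | |F 0 t| ≤ μ} ∩ Set.Ioc x y) ≠ ⊤ :=
    ((measure_mono Set.inter_subset_right).trans_lt measure_Ioc_lt_top).ne
  have hE : ENNReal.ofReal (2 * (2 ^ k : ℕ) * τ) <
      volume ({t | |F 0 t| ≤ μ} ∩ Set.Ioc x y) := by
    rw [ENNReal.ofReal_lt_iff_lt_toReal (by positivity) hfin]
    push_cast
    exact hcon
  obtain ⟨p, hp, hs⟩ := exists_spaced_points hτ _ _
    ⟨x, fun z hz => hz.2.1.le⟩ hE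
  obtain ⟨ξ, hξ, h⟩ := exists_derivs_small_of_spaced hτ l F μ (2 ^ k)
    ((Nat.pow_le_pow_right (by norm_num) hl).trans (Nat.le_succ _))
    (fun i hi => hF i (by omega)) ⟨p, fun i hi => ⟨Set.Ioc_subset_Icc_self (hp i hi).2,
      (hp i hi).1⟩, hs⟩
  have hd := (convex_Icc x y).norm_image_sub_le_of_norm_hasDerivWithin_le
    (fun z hz => (hF l hl z hz).hasDerivWithinAt) (fun z hz => hM l hl z hz) hξ ht
  rw [Real.norm_eq_abs, Real.norm_eq_abs] at hd
  have h1 : |t - ξ| ≤ y - x := abs_sub_le_iff.2 ⟨by linarith [ht.2, hξ.1], by linarith [hξ.2, ht.1]⟩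
  have hM0 : 0 ≤ M := (abs_nonneg _).trans (hM l hl t ht)
  have h2 : (2 / τ) ^ l * μ ≤ (2 / τ) ^ k * μ := by
    gcongr
    rw [one_le_div hτ]; exact hτ2
  have h3 : |F l t| ≤ |F l t - F l ξ| + |F l ξ| := by
    simpa using abs_add_le (F l t - F l ξ) (F l ξ)
  have h4 : M * |t - ξ| ≤ M * (y - x) := by gcongr
  linarith

/-! ### Oscillatory integrals -/

/-- First derivative test: integrate by parts against `(exp (iΦ))' / (iΦ')`. The sign condition on
`g = Φ''` makes `∫ |Φ''| / Φ' ^ 2` telescope. -/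
lemma norm_integral_exp_le_of_deriv_ge {Φ Φ₁ g ψ ψ₁ : ℝ → ℝ} {a b A δ : ℝ} (hab : a ≤ b)
    (hδ : 0 < δ)
    (hΦ : ∀ t ∈ Set.Icc a b, HasDerivAt Φ (Φ₁ t) t)
    (hΦ₁ : ∀ t ∈ Set.Icc a b, HasDerivAt Φ₁ (g t) t)
    (hg : ContinuousOn g (Set.Icc a b))
    (hψ : ∀ t ∈ Set.Icc a b, HasDerivAt ψ (ψ₁ t) t)
    (hψ₁ : ContinuousOn ψ₁ (Set.Icc a b))
    (hA : ∀ t ∈ Set.Icc a b, |ψ t| ≤ A) (hA₁ : ∀ t ∈ Set.Icc a b, |ψ₁ t| ≤ A)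
    (hbig : ∀ t ∈ Set.Icc a b, δ ≤ |Φ₁ t|)
    (hsign : (∀ t ∈ Set.Icc a b, 0 ≤ g t) ∨ ∀ t ∈ Set.Icc a b, g t ≤ 0) :
    ‖∫ t in a..b, Complex.exp (Complex.I * (Φ t : ℂ)) * (ψ t : ℂ)‖ ≤ A * (4 + (b - a)) / δ := by
  have hA0 : 0 ≤ A := (abs_nonneg _).trans (hA a ⟨le_rfl, hab⟩)
  have hne : ∀ t ∈ Set.Icc a b, Φ₁ t ≠ 0 := fun t ht h => by
    have := hbig t ht
    rw [h, abs_zero] at this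
    linarith
  have hcΦ₁ : ContinuousOn Φ₁ (Set.Icc a b) := fun t ht =>
    (hΦ₁ t ht).continuousAt.continuousWithinAt
  have hcΦ : ContinuousOn Φ (Set.Icc a b) := fun t ht => (hΦ t ht).continuousAt.continuousWithinAt
  have hcψ : ContinuousOn ψ (Set.Icc a b) := fun t ht => (hψ t ht).continuousAt.continuousWithinAt
  have hu' : ∀ t ∈ Set.uIcc a b, HasDerivAt (fun t => ((ψ t / Φ₁ t : ℝ) : ℂ))
      (((ψ₁ t * Φ₁ t - ψ t * g t) / Φ₁ t ^ 2 : ℝ) : ℂ) t := by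
    intro t ht
    rw [Set.uIcc_of_le hab] at ht
    exact ((hψ t ht).div (hΦ₁ t ht) (hne t ht)).ofReal_comp
  have hv' : ∀ t ∈ Set.uIcc a b, HasDerivAt (fun t => Complex.exp (Complex.I * (Φ t : ℂ)))
      (Complex.exp (Complex.I * (Φ t : ℂ)) * (Complex.I * (Φ₁ t : ℂ))) t := by
    intro t ht
    rw [Set.uIcc_of_le hab] at ht
    exact ((hΦ t ht).ofReal_comp.const_mul Complex.I).cexp
  have hcu' : ContinuousOn (fun t => (ψ₁ t * Φ₁ t - ψ t * g t) / Φ₁ t ^ 2) (Set.Icc a b) :=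
    ((hψ₁.mul hcΦ₁).sub (hcψ.mul hg)).div (hcΦ₁.pow 2) fun t ht => pow_ne_zero 2 (hne t ht)
  have hcexp : ContinuousOn (fun t => Complex.exp (Complex.I * (Φ t : ℂ))) (Set.Icc a b) :=
    (continuousOn_const.mul (Complex.continuous_ofReal.comp_continuousOn hcΦ)).cexp
  have hparts := intervalIntegral.integral_mul_deriv_eq_deriv_mul hu' hv'
    (ContinuousOn.intervalIntegrable (by
      rw [Set.uIcc_of_le hab]
      exact Complex.continuous_ofReal.comp_continuousOn hcu'))
    (ContinuousOn.intervalIntegrable (by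
      rw [Set.uIcc_of_le hab]
      exact hcexp.mul (continuousOn_const.mul
        (Complex.continuous_ofReal.comp_continuousOn hcΦ₁))))
  have heq : ∫ t in a..b, Complex.exp (Complex.I * (Φ t : ℂ)) * (ψ t : ℂ) =
      -Complex.I * ∫ t in a..b, ((ψ t / Φ₁ t : ℝ) : ℂ) *
        (Complex.exp (Complex.I * (Φ t : ℂ)) * (Complex.I * (Φ₁ t : ℂ))) := by
    rw [← intervalIntegral.integral_const_mul]
    refine intervalIntegral.integral_congr fun t ht => ?_
    rw [Set.uIcc_of_le hab] at ht
    have : (Φ₁ t : ℂ) ≠ 0 := by exact_mod_cast hne t ht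
    push_cast
    field_simp
    rw [Complex.I_sq]
    ring
  have hnexp : ∀ t, ‖Complex.exp (Complex.I * (Φ t : ℂ))‖ = 1 := fun t => by
    rw [mul_comm]; exact Complex.norm_exp_ofReal_mul_I _
  have hbd : ∀ t ∈ Set.Icc a b, |ψ t / Φ₁ t| ≤ A / δ := fun t ht => by
    rw [abs_div]
    exact div_le_div₀ hA0 (hA t ht) hδ (hbig t ht)
  -- the variation of `1 / Φ₁`
  have hcq : ContinuousOn (fun t => g t / Φ₁ t ^ 2) (Set.Icc a b) :=
    hg.div (hcΦ₁.pow 2) fun t ht => pow_ne_zero 2 (hne t ht)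
  have hftc : ∫ t in a..b, g t / Φ₁ t ^ 2 = (Φ₁ a)⁻¹ - (Φ₁ b)⁻¹ := by
    have := intervalIntegral.integral_eq_sub_of_hasDerivAt (f := fun t => -(Φ₁ t)⁻¹)
      (f' := fun t => g t / Φ₁ t ^ 2) (a := a) (b := b) (fun t ht => by
        rw [Set.uIcc_of_le hab] at ht
        exact ((hΦ₁ t ht).inv (hne t ht)).neg.congr_deriv (by ring))
      (ContinuousOn.intervalIntegrable (by rwa [Set.uIcc_of_le hab]))
    rw [this]; ring
  have hinv : ∀ t ∈ Set.Icc a b, |(Φ₁ t)⁻¹| ≤ 1 / δ := fun t ht => by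
    rw [abs_inv, ← one_div]
    exact one_div_le_one_div_of_le hδ (hbig t ht)
  have hvar : ∫ t in a..b, |g t| / Φ₁ t ^ 2 ≤ 2 / δ := by
    have h1 : |∫ t in a..b, g t / Φ₁ t ^ 2| ≤ 2 / δ := by
      rw [hftc]
      refine (abs_sub _ _).trans ((add_le_add (hinv a ⟨le_rfl, hab⟩) (hinv b ⟨hab, le_rfl⟩)).trans
        (le_of_eq (by ring)))
    rcases hsign with hs | hs
    · rw [intervalIntegral.integral_congr (g := fun t => g t / Φ₁ t ^ 2) fun t ht => by
        rw [Set.uIcc_of_le hab] at ht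
        simp only [abs_of_nonneg (hs t ht)]]
      exact (le_abs_self _).trans h1
    · rw [intervalIntegral.integral_congr (g := fun t => -(g t / Φ₁ t ^ 2)) fun t ht => by
        rw [Set.uIcc_of_le hab] at ht
        simp only [abs_of_nonpos (hs t ht), neg_div], intervalIntegral.integral_neg]
      exact (neg_le_abs _).trans h1
  have hrest : ‖∫ t in a..b, (((ψ₁ t * Φ₁ t - ψ t * g t) / Φ₁ t ^ 2 : ℝ) : ℂ) *
      Complex.exp (Complex.I * (Φ t : ℂ))‖ ≤ A / δ * (b - a) + A * (2 / δ) := by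
    have hint : IntervalIntegrable (fun t => |g t| / Φ₁ t ^ 2) volume a b :=
      ContinuousOn.intervalIntegrable (by
        rw [Set.uIcc_of_le hab]
        exact hg.abs.div (hcΦ₁.pow 2) fun t ht => pow_ne_zero 2 (hne t ht))
    refine (intervalIntegral.norm_integral_le_of_norm_le hab
      (g := fun t => A / δ + A * (|g t| / Φ₁ t ^ 2)) ?_
      (intervalIntegrable_const.add (hint.const_mul A))).trans ?_
    · refine Filter.Eventually.of_forall fun t ht => ?_
      have ht := Set.Ioc_subset_Icc_self ht
      rw [norm_mul, hnexp, mul_one, Complex.norm_real, Real.norm_eq_abs, sub_div]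
      refine (abs_sub _ _).trans (add_le_add ?_ ?_)
      · rw [sq, mul_div_mul_right _ _ (hne t ht), abs_div]
        exact div_le_div₀ hA0 (hA₁ t ht) hδ (hbig t ht)
      · rw [mul_div_assoc, abs_mul, abs_div, abs_of_nonneg (sq_nonneg (Φ₁ t))]
        gcongr
        exact hA t ht
    · rw [intervalIntegral.integral_add intervalIntegrable_const (hint.const_mul A),
        intervalIntegral.integral_const, intervalIntegral.integral_const_mul, smul_eq_mul]
      have := mul_le_mul_of_nonneg_left hvar hA0
      linarith
  rw [heq, norm_mul, norm_neg, Complex.norm_I, one_mul, hparts]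
  refine (norm_sub_le _ _).trans ((add_le_add (norm_sub_le _ _) hrest).trans ?_)
  rw [norm_mul, norm_mul, hnexp, hnexp, Complex.norm_real, Complex.norm_real, Real.norm_eq_abs,
    Real.norm_eq_abs]
  have h1 := hbd a ⟨le_rfl, hab⟩
  have h2 := hbd b ⟨hab, le_rfl⟩
  have h3 : A * (4 + (b - a)) / δ = A / δ + A / δ + (A / δ * (b - a) + A * (2 / δ)) := by ring
  rw [h3]
  linarith

lemma pos_or_neg_of_continuousOn_Icc {g : ℝ → ℝ} {a b : ℝ} (hg : ContinuousOn g (Set.Icc a b))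
    (hne : ∀ t ∈ Set.Icc a b, g t ≠ 0) :
    (∀ t ∈ Set.Icc a b, 0 < g t) ∨ ∀ t ∈ Set.Icc a b, g t < 0 := by
  by_contra! hcon
  obtain ⟨⟨t, ht, h1⟩, u, hu, h2⟩ := hcon
  obtain ⟨z, hz, h⟩ := isPreconnected_Icc.intermediate_value ht hu hg ⟨h1, h2⟩
  exact hne z hz h

/-- If `|Φ₁'| ≥ L` then `Φ₁` grows at least linearly away from the point where `|Φ₁|` is minimal. -/
lemma exists_linear_growth {Φ₁ g : ℝ → ℝ} {a b L : ℝ} (hab : a ≤ b)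
    (hΦ₁ : ∀ t ∈ Set.Icc a b, HasDerivAt Φ₁ (g t) t)
    (hbig : ∀ t ∈ Set.Icc a b, L ≤ |g t|) :
    ∃ c ∈ Set.Icc a b, ∀ t ∈ Set.Icc a b, L * |t - c| ≤ |Φ₁ t| := by
  have hc : ContinuousOn Φ₁ (Set.Icc a b) := fun t ht => (hΦ₁ t ht).continuousAt.continuousWithinAt
  obtain ⟨c, hcm, hmin⟩ := isCompact_Icc.exists_isMinOn (Set.nonempty_Icc.2 hab) hc.abs
  refine ⟨c, hcm, fun t ht => ?_⟩
  have hgrow : L * |t - c| ≤ |Φ₁ t - Φ₁ c| := by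
    have aux : ∀ u ∈ Set.Icc a b, ∀ v ∈ Set.Icc a b, u < v → L * (v - u) ≤ |Φ₁ v - Φ₁ u| := by
      intro u hu v hv huv
      obtain ⟨z, hz, h⟩ := exists_hasDerivAt_eq_slope Φ₁ g huv
        (hc.mono (Set.Icc_subset_Icc hu.1 hv.2))
        (fun z hz => hΦ₁ z ⟨hu.1.trans hz.1.le, hz.2.le.trans hv.2⟩)
      have hpos : 0 < v - u := sub_pos.2 huv
      have h2 := hbig z ⟨hu.1.trans hz.1.le, hz.2.le.trans hv.2⟩
      rwa [h, abs_div, abs_of_pos hpos, le_div_iff₀ hpos] at h2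
    rcases lt_trichotomy t c with h | h | h
    · rw [abs_sub_comm t, abs_of_pos (sub_pos.2 h), abs_sub_comm]
      exact aux t ht c hcm h
    · simp [h]
    · rw [abs_of_pos (sub_pos.2 h)]
      exact aux c hcm t ht h
  refine hgrow.trans ?_
  have hm : |Φ₁ c| ≤ |Φ₁ t| := hmin ht
  by_cases h0 : Φ₁ c = 0
  · simp [h0]
  · have hne : ∀ z ∈ Set.Icc a b, Φ₁ z ≠ 0 := fun z hz h => by
      have : |Φ₁ c| ≤ |Φ₁ z| := hmin hz
      rw [h, abs_zero] at this
      exact h0 (abs_nonpos_iff.1 this)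
    rcases pos_or_neg_of_continuousOn_Icc hc hne with hs | hs
    · have h1 := hs c hcm
      have h2 := hs t ht
      rw [abs_of_pos h1, abs_of_pos h2] at hm
      rw [abs_of_pos h2, abs_of_nonneg (sub_nonneg.2 hm)]
      linarith
    · have h1 := hs c hcm
      have h2 := hs t ht
      rw [abs_of_neg h1, abs_of_neg h2] at hm
      rw [abs_of_neg h2, abs_of_nonpos (by linarith)]
      linarith

/-- Second derivative test of van der Corput: an interval of length `2 / δ` around the minimum of
`|Φ'|` is removed, and the first derivative test applies on the rest. -/
lemma norm_integral_exp_le_of_deriv2_ge {Φ Φ₁ g ψ ψ₁ : ℝ → ℝ} {a b A δ : ℝ} (hab : a ≤ b)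
    (hδ : 0 < δ)
    (hΦ : ∀ t ∈ Set.Icc a b, HasDerivAt Φ (Φ₁ t) t)
    (hΦ₁ : ∀ t ∈ Set.Icc a b, HasDerivAt Φ₁ (g t) t)
    (hg : ContinuousOn g (Set.Icc a b))
    (hψ : ∀ t ∈ Set.Icc a b, HasDerivAt ψ (ψ₁ t) t)
    (hψ₁ : ContinuousOn ψ₁ (Set.Icc a b))
    (hA : ∀ t ∈ Set.Icc a b, |ψ t| ≤ A) (hA₁ : ∀ t ∈ Set.Icc a b, |ψ₁ t| ≤ A)
    (hbig : ∀ t ∈ Set.Icc a b, δ ^ 2 ≤ |g t|) :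
    ‖∫ t in a..b, Complex.exp (Complex.I * (Φ t : ℂ)) * (ψ t : ℂ)‖ ≤
      A * (10 + 2 * (b - a)) / δ := by
  have hA0 : 0 ≤ A := (abs_nonneg _).trans (hA a ⟨le_rfl, hab⟩)
  obtain ⟨c, hc, hgrow⟩ := exists_linear_growth hab hΦ₁ hbig
  have hcΦ : ContinuousOn Φ (Set.Icc a b) := fun t ht => (hΦ t ht).continuousAt.continuousWithinAt
  have hcψ : ContinuousOn ψ (Set.Icc a b) := fun t ht => (hψ t ht).continuousAt.continuousWithinAt
  have hcont : ContinuousOn (fun t => Complex.exp (Complex.I * (Φ t : ℂ)) * (ψ t : ℂ))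
      (Set.Icc a b) :=
    (continuousOn_const.mul (Complex.continuous_ofReal.comp_continuousOn hcΦ)).cexp.mul
      (Complex.continuous_ofReal.comp_continuousOn hcψ)
  have hsign : (∀ t ∈ Set.Icc a b, 0 < g t) ∨ ∀ t ∈ Set.Icc a b, g t < 0 :=
    pos_or_neg_of_continuousOn_Icc hg fun t ht h => by
      have := hbig t ht
      rw [h, abs_zero] at this
      exact absurd this (not_le.2 (pow_pos hδ 2))
  have outer : ∀ x y, a ≤ x → x ≤ y → y ≤ b → (∀ t ∈ Set.Icc x y, 1 / δ ≤ |t - c|) →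
      ‖∫ t in x..y, Complex.exp (Complex.I * (Φ t : ℂ)) * (ψ t : ℂ)‖ ≤ A * (4 + (b - a)) / δ := by
    intro x y hx hxy hy hfar
    have hsub : Set.Icc x y ⊆ Set.Icc a b := Set.Icc_subset_Icc hx hy
    refine (norm_integral_exp_le_of_deriv_ge hxy hδ (fun t ht => hΦ t (hsub ht))
      (fun t ht => hΦ₁ t (hsub ht)) (hg.mono hsub) (fun t ht => hψ t (hsub ht)) (hψ₁.mono hsub)
      (fun t ht => hA t (hsub ht)) (fun t ht => hA₁ t (hsub ht)) (fun t ht => ?_)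
      (hsign.imp (fun h t ht => (h t (hsub ht)).le) (fun h t ht => (h t (hsub ht)).le))).trans ?_
    · refine le_trans ?_ (hgrow t (hsub ht))
      calc δ = δ ^ 2 * (1 / δ) := by field_simp
        _ ≤ _ := by gcongr; exact hfar t ht
    · gcongr
  have hδi : 0 < 1 / δ := by positivity
  set x := max a (c - 1 / δ) with hx
  set y := min b (c + 1 / δ) with hy
  have hax : a ≤ x := le_max_left _ _
  have hxc : x ≤ c := max_le hc.1 (by linarith)
  have hcy : c ≤ y := le_min hc.2 (by linarith)
  have hyb : y ≤ b := min_le_left _ _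
  have hii : ∀ u v, a ≤ u → u ≤ v → v ≤ b → IntervalIntegrable
      (fun t => Complex.exp (Complex.I * (Φ t : ℂ)) * (ψ t : ℂ)) volume u v := fun u v h1 h2 h3 =>
    ContinuousOn.intervalIntegrable (by
      rw [Set.uIcc_of_le h2]
      exact hcont.mono (Set.Icc_subset_Icc h1 h3))
  have hI := hii a x le_rfl hax (hxc.trans hc.2)
  have hII := hii x y hax (hxc.trans hcy) hyb
  have hIII := hii y b (hax.trans (hxc.trans hcy)) hyb le_rfl
  rw [← intervalIntegral.integral_add_adjacent_intervals (hI.trans hII) hIII,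
    ← intervalIntegral.integral_add_adjacent_intervals hI hII]
  have h1 : ‖∫ t in a..x, Complex.exp (Complex.I * (Φ t : ℂ)) * (ψ t : ℂ)‖ ≤
      A * (4 + (b - a)) / δ := by
    rcases le_total (c - 1 / δ) a with h | h
    · rw [hx, max_eq_left h, intervalIntegral.integral_same, norm_zero]
      have : 0 ≤ b - a := by linarith
      positivity
    · refine outer a x le_rfl hax (hxc.trans hc.2) fun t ht => ?_
      have : t ≤ c - 1 / δ := by have := ht.2; rwa [hx, max_eq_right h] at this
      rw [abs_sub_comm]
      exact le_trans (by linarith) (le_abs_self _)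
  have h3 : ‖∫ t in y..b, Complex.exp (Complex.I * (Φ t : ℂ)) * (ψ t : ℂ)‖ ≤
      A * (4 + (b - a)) / δ := by
    rcases le_total b (c + 1 / δ) with h | h
    · rw [hy, min_eq_left h, intervalIntegral.integral_same, norm_zero]
      have : 0 ≤ b - a := by linarith
      positivity
    · refine outer y b (hax.trans (hxc.trans hcy)) hyb le_rfl fun t ht => ?_
      have : c + 1 / δ ≤ t := by have := ht.1; rwa [hy, min_eq_right h] at this
      exact le_trans (by linarith) (le_abs_self _)
  have h2 : ‖∫ t in x..y, Complex.exp (Complex.I * (Φ t : ℂ)) * (ψ t : ℂ)‖ ≤ A * (2 / δ) := by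
    refine (intervalIntegral.norm_integral_le_of_norm_le_const (C := A) fun t ht => ?_).trans ?_
    · rw [Set.uIoc_of_le (hxc.trans hcy)] at ht
      rw [norm_mul, mul_comm Complex.I, Complex.norm_exp_ofReal_mul_I, one_mul, Complex.norm_real]
      exact hA t ⟨hax.trans ht.1.le, ht.2.trans hyb⟩
    · rw [abs_of_nonneg (by linarith)]
      gcongr
      have := le_max_right a (c - 1 / δ)
      have := min_le_right b (c + 1 / δ)
      have : 2 / δ = 1 / δ + 1 / δ := by ring
      linarith
  refine (norm_add₃_le).trans ((add_le_add (add_le_add h1 h2) h3).trans (le_of_eq ?_))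
  ring

/-! ### Generalized polynomials and Euler operators -/

/-- The `l`-th derivative of the generalized polynomial `t ↦ ∑ k, b k * t ^ β k` on `t > 0`. -/
noncomputable def genPoly {d : ℕ} (β b : Fin d → ℝ) (l : ℕ) (t : ℝ) : ℝ :=
  ∑ k, b k * ((descPochhammer ℝ l).eval (β k) * t ^ (β k - l))

lemma hasDerivAt_genPoly {d : ℕ} (β b : Fin d → ℝ) (l : ℕ) {t : ℝ} (ht : 0 < t) :
    HasDerivAt (genPoly β b l) (genPoly β b (l + 1) t) t := by
  unfold genPoly
  refine HasDerivAt.fun_sum fun k _ => ?_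
  refine (((Real.hasDerivAt_rpow_const (p := β k - l) (Or.inl ht.ne')).const_mul
    ((descPochhammer ℝ l).eval (β k))).const_mul (b k)).congr_deriv ?_
  rw [descPochhammer_succ_eval]
  push_cast
  rw [sub_sub]
  ring

lemma rpow_le_four_rpow_abs {t : ℝ} (ht : t ∈ Set.Icc (1 / 4 : ℝ) 4) (p : ℝ) :
    t ^ p ≤ 4 ^ |p| := by
  have ht0 : 0 < t := by linarith [ht.1]
  rcases le_total 0 p with hp | hp
  · rw [abs_of_nonneg hp]
    exact Real.rpow_le_rpow ht0.le ht.2 hp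
  · rw [abs_of_nonpos hp, ← neg_neg p, Real.rpow_neg ht0.le, neg_neg, ← Real.inv_rpow ht0.le]
    refine Real.rpow_le_rpow (by positivity) ?_ (by linarith)
    rw [inv_le_comm₀ ht0 (by norm_num)]
    linarith [ht.1]

/-- On `[1/4, 4]` the derivatives up to order `L` are bounded by the size of the coefficients. -/
lemma exists_genPoly_le {d : ℕ} (β : Fin d → ℝ) (L : ℕ) :
    ∃ M : ℝ, 0 < M ∧ ∀ (b : Fin d → ℝ), ∀ l ≤ L, ∀ t ∈ Set.Icc (1 / 4 : ℝ) 4,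
      |genPoly β b l t| ≤ M * ∑ k, |b k| := by
  set c : Fin d → ℕ → ℝ := fun k l => |(descPochhammer ℝ l).eval (β k)| * 4 ^ |β k - l| with hc
  have hc0 : ∀ k l, 0 ≤ c k l := fun k l => by positivity
  refine ⟨1 + ∑ k, ∑ l ∈ Finset.range (L + 1), c k l, by positivity, fun b l hl t ht => ?_⟩
  unfold genPoly
  rw [Finset.mul_sum]
  refine (Finset.abs_sum_le_sum_abs _ _).trans (Finset.sum_le_sum fun k _ => ?_)
  rw [abs_mul, mul_comm]
  gcongr
  have h1 : |(descPochhammer ℝ l).eval (β k) * t ^ (β k - l)| ≤ c k l := by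
    rw [abs_mul]
    have ht0 : 0 < t := by linarith [ht.1]
    rw [abs_of_pos (Real.rpow_pos_of_pos ht0 _)]
    exact mul_le_mul_of_nonneg_left (rpow_le_four_rpow_abs ht _) (abs_nonneg _)
  have h2 : c k l ≤ ∑ l ∈ Finset.range (L + 1), c k l :=
    Finset.single_le_sum (f := fun l => c k l) (fun l _ => hc0 k l)
      (Finset.mem_range.2 (by omega))
  have h3 : ∑ l ∈ Finset.range (L + 1), c k l ≤ ∑ k, ∑ l ∈ Finset.range (L + 1), c k l :=
    Finset.single_le_sum (f := fun k => ∑ l ∈ Finset.range (L + 1), c k l)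
      (fun k _ => Finset.sum_nonneg fun l _ => hc0 k l) (Finset.mem_univ k)
  linarith

/-- Newton expansion of a product of linear factors in falling factorials. -/
lemma exists_newton_expansion {d : ℕ} (β : Fin d → ℝ) (S : Finset (Fin d)) :
    ∃ c : ℕ → ℝ, (∀ j, S.card < j → c j = 0) ∧ ∀ x : ℝ,
      ∑ j ∈ Finset.range (d + 1), c j * (descPochhammer ℝ j).eval x = ∏ k ∈ S, (x - β k) := by
  classical
  induction S using Finset.induction_on with
  | empty =>
    refine ⟨fun j => if j = 0 then 1 else 0, fun j hj => ?_, fun x => ?_⟩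
    · exact if_neg (by simpa using hj.ne')
    · simp
  | insert a S ha ih =>
    obtain ⟨c, hc, hx⟩ := ih
    rw [Finset.card_insert_of_notMem ha]
    have hcard : S.card < d := by
      have := Finset.card_le_univ (insert a S)
      rw [Finset.card_insert_of_notMem ha, Fintype.card_fin] at this
      omega
    refine ⟨fun j => (j - β a) * c j + if j = 0 then 0 else c (j - 1), fun j hj => ?_, fun x => ?_⟩
    · simp [hc j (by omega), hc (j - 1) (by omega)]
    · rw [Finset.prod_insert ha, ← hx x, Finset.mul_sum]
      -- `x * x^{(j)} = x^{(j+1)} + j * x^{(j)}` for falling factorials `x^{(j)}`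
      have h1 : ∀ j, (x - β a) * (c j * (descPochhammer ℝ j).eval x) =
          (j - β a) * c j * (descPochhammer ℝ j).eval x +
            c j * (descPochhammer ℝ (j + 1)).eval x := fun j => by
        rw [descPochhammer_succ_eval]; ring
      simp only [h1, add_mul]
      rw [Finset.sum_add_distrib, Finset.sum_add_distrib, add_right_inj,
        Finset.sum_range_succ' _ d, Finset.sum_range_succ _ d, hc d hcard]
      simp

/-- The Euler operator `∑ j, c j * t ^ j * (d/dt) ^ j` acts on `t ^ β` as multiplication by
`∑ j, c j * β (β - 1) ⋯ (β - j + 1)`. -/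
lemma sum_mul_pow_mul_genPoly {d : ℕ} (β b : Fin d → ℝ) (c : ℕ → ℝ) (n : ℕ) {t : ℝ} (ht : 0 < t) :
    ∑ j ∈ Finset.range n, c j * t ^ j * genPoly β b j t =
      ∑ k, b k * (∑ j ∈ Finset.range n, c j * (descPochhammer ℝ j).eval (β k)) * t ^ β k := by
  unfold genPoly
  simp only [Finset.mul_sum, Finset.sum_mul]
  rw [Finset.sum_comm]
  refine Finset.sum_congr rfl fun k _ => Finset.sum_congr rfl fun j _ => ?_
  rw [Real.rpow_sub ht, Real.rpow_natCast]
  have : t ^ j ≠ 0 := by positivity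
  field_simp

/-- If all derivatives of order at most `d` of a generalized polynomial with `d` distinct exponents
are small at a point, then all its coefficients are small: the Euler operator annihilating all
powers but one isolates the coefficient of that power. -/
lemma exists_sum_abs_le_of_genPoly_le {d : ℕ} (β : Fin d → ℝ) (hβ : Function.Injective β) :
    ∃ C : ℝ, 0 < C ∧ ∀ (b : Fin d → ℝ) (η : ℝ), 0 ≤ η → ∀ t ∈ Set.Icc (1 / 4 : ℝ) 4,
      (∀ l ≤ d, |genPoly β b l t| ≤ η) → ∑ k, |b k| ≤ C * η := by
  classical
  choose c _ hx using fun k : Fin d => exists_newton_expansion β (Finset.univ.erase k)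
  set D : Fin d → ℝ := fun k =>
    |(∏ i ∈ Finset.univ.erase k, (β k - β i))⁻¹| * 4 ^ |β k| *
      ∑ j ∈ Finset.range (d + 1), |c k j| * 4 ^ j with hD
  have hD0 : ∀ k, 0 ≤ D k := fun k => by positivity
  refine ⟨1 + ∑ k, D k, by positivity, fun b η hη t ht hl => ?_⟩
  have ht0 : 0 < t := by linarith [ht.1]
  have key : ∀ k, |b k| ≤ D k * η := by
    intro k
    have hP : ∏ i ∈ Finset.univ.erase k, (β k - β i) ≠ 0 :=
      Finset.prod_ne_zero_iff.2 fun i hi => sub_ne_zero.2 fun h =>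
        (Finset.mem_erase.1 hi).1 (hβ h).symm
    have h1 := sum_mul_pow_mul_genPoly β b (c k) (d + 1) ht0
    simp only [hx] at h1
    rw [Finset.sum_eq_single k (fun i _ hik => by
      rw [Finset.prod_eq_zero (Finset.mem_erase.2 ⟨hik, Finset.mem_univ i⟩) (sub_self _)]
      simp) (by simp)] at h1
    have h2 : b k = (∏ i ∈ Finset.univ.erase k, (β k - β i))⁻¹ * t ^ (-β k) *
        ∑ j ∈ Finset.range (d + 1), c k j * t ^ j * genPoly β b j t := by
      rw [h1, Real.rpow_neg ht0.le]
      have := (Real.rpow_pos_of_pos ht0 (β k)).ne'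
      field_simp
    have h3 : |∑ j ∈ Finset.range (d + 1), c k j * t ^ j * genPoly β b j t| ≤
        (∑ j ∈ Finset.range (d + 1), |c k j| * 4 ^ j) * η := by
      rw [Finset.sum_mul]
      refine (Finset.abs_sum_le_sum_abs _ _).trans (Finset.sum_le_sum fun j hj => ?_)
      rw [abs_mul, abs_mul, abs_of_nonneg (pow_nonneg ht0.le j)]
      gcongr
      · exact ht.2
      · exact hl j (by have := Finset.mem_range.1 hj; omega)
    rw [h2, abs_mul, abs_mul, abs_of_pos (Real.rpow_pos_of_pos ht0 _), hD]
    simp only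
    rw [mul_assoc _ _ η]
    have := rpow_le_four_rpow_abs ht (-β k)
    rw [abs_neg] at this
    gcongr
  calc ∑ k, |b k| ≤ ∑ k, D k * η := Finset.sum_le_sum fun k _ => key k
    _ = (∑ k, D k) * η := by rw [Finset.sum_mul]
    _ ≤ _ := by gcongr; linarith

/-- A polynomial of degree at most `d` that is small on a large part of `[1/4, 4]` has a small
constant coefficient, by Lagrange interpolation at `0` through separated nodes. -/
lemma volume_sublevel_polynomial_le {d : ℕ} (q : ℕ → ℝ) {τ ν : ℝ} (hτ : 0 < τ)
    (hbig : (d + 1) * (4 / τ) ^ d * ν < |q 0|) :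
    volume {u | u ∈ Set.Icc (1 / 4 : ℝ) 4 ∧ |∑ j ∈ Finset.range (d + 1), q j * u ^ j| ≤ ν} ≤
      ENNReal.ofReal (2 * d * τ) := by
  by_contra! hcon
  obtain ⟨p, hp, hs⟩ := exists_spaced_points hτ d _ ⟨1 / 4, fun u hu => hu.1.1⟩ hcon
  have hsep : ∀ i j, i < j → j ≤ d → p i + τ ≤ p j := by
    intro i j hij
    induction j, hij using Nat.le_induction with
    | base => exact fun h => hs i (by omega)
    | succ j hj ih => exact fun h => by linarith [ih (by omega), hs j (by omega)]
  have hdist : ∀ i ≤ d, ∀ j ≤ d, i ≠ j → τ ≤ |p i - p j| := by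
    intro i hi j hj hij
    rcases lt_or_gt_of_ne hij with h | h
    · rw [abs_sub_comm]
      exact le_trans (by linarith [hsep i j h hj]) (le_abs_self _)
    · exact le_trans (by linarith [hsep j i h hi]) (le_abs_self _)
  have hinj : Set.InjOn p (Finset.range (d + 1)) := by
    intro i hi j hj hij
    by_contra h
    have := hdist i (by have := Finset.mem_range.1 hi; omega) j
      (by have := Finset.mem_range.1 hj; omega) h
    rw [hij, sub_self, abs_zero] at this
    linarith
  set P : Polynomial ℝ := ∑ j ∈ Finset.range (d + 1), Polynomial.C (q j) * Polynomial.X ^ j with hP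
  have heval : ∀ u, P.eval u = ∑ j ∈ Finset.range (d + 1), q j * u ^ j := fun u => by
    simp [hP, Polynomial.eval_finsetSum]
  have hdeg : P.degree < (Finset.range (d + 1)).card := by
    rw [Finset.card_range]
    refine (Polynomial.degree_sum_le _ _).trans_lt ((Finset.sup_lt_iff (by simp)).2 fun j hj => ?_)
    exact (Polynomial.degree_C_mul_X_pow_le j (q j)).trans_lt
      (by exact_mod_cast Finset.mem_range.1 hj)
  have h0 : P.eval 0 = q 0 := by
    rw [heval, Finset.sum_range_succ']
    simp
  rw [← h0, Lagrange.eq_interpolate hinj hdeg, Lagrange.interpolate_apply,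
    Polynomial.eval_finsetSum] at hbig
  refine absurd hbig (not_lt.2 ((Finset.abs_sum_le_sum_abs _ _).trans ?_))
  have hterm : ∀ i ∈ Finset.range (d + 1),
      |(Polynomial.C (P.eval (p i)) * Lagrange.basis (Finset.range (d + 1)) p i).eval 0| ≤
        (4 / τ) ^ d * ν := by
    intro i hi
    have hid : i ≤ d := by have := Finset.mem_range.1 hi; omega
    rw [Polynomial.eval_mul, Polynomial.eval_C, abs_mul, mul_comm, heval]
    refine mul_le_mul ?_ (hp i hid).2 (abs_nonneg _) (by positivity)
    rw [Lagrange.basis, Polynomial.eval_prod, Finset.abs_prod]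
    have hcard : ((Finset.range (d + 1)).erase i).card = d := by
      rw [Finset.card_erase_of_mem hi, Finset.card_range]; rfl
    calc _ ≤ ∏ j ∈ (Finset.range (d + 1)).erase i, 4 / τ := by
          refine Finset.prod_le_prod (fun _ _ => abs_nonneg _) fun j hj => ?_
          have hj' := Finset.mem_erase.1 hj
          have hjd : j ≤ d := by have := Finset.mem_range.1 hj'.2; omega
          have h4 : |p j| ≤ 4 := by
            have := (hp j hjd).1
            rw [abs_of_nonneg (by linarith [this.1])]
            exact this.2
          simp only [Lagrange.basisDivisor, Polynomial.eval_mul, Polynomial.eval_C,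
            Polynomial.eval_sub, Polynomial.eval_X, zero_sub, abs_mul, abs_neg, abs_inv]
          rw [mul_comm, ← div_eq_mul_inv]
          exact div_le_div₀ (by norm_num) h4 hτ (hdist i hid j hjd hj'.1.symm)
      _ = (4 / τ) ^ d := by rw [Finset.prod_const, hcard]
  refine (Finset.sum_le_sum hterm).trans (le_of_eq ?_)
  rw [Finset.sum_const, Finset.card_range, nsmul_eq_mul]
  push_cast
  ring

/-! ### The phase of the `TT*` kernel -/

lemma volume_real_inter_Ioc_le (E : Set ℝ) (x y z : ℝ) :
    volume.real (E ∩ Set.Ioc x z) ≤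
      volume.real (E ∩ Set.Ioc x y) + volume.real (E ∩ Set.Ioc y z) := by
  have hfin : ∀ u v, volume (E ∩ Set.Ioc u v) ≠ ⊤ := fun u v =>
    ((measure_mono Set.inter_subset_right).trans_lt measure_Ioc_lt_top).ne
  refine (measureReal_mono ?_ (measure_union_ne_top (hfin x y) (hfin y z))).trans
    (measureReal_union_le _ _)
  rw [← Set.inter_union_distrib_left]
  exact Set.inter_subset_inter_right _ Set.Ioc_subset_Ioc_union_Ioc

lemma volume_real_inter_Ioc_add {E : Set ℝ} (hE : MeasurableSet E) {x y z : ℝ} (hxy : x ≤ y)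
    (hyz : y ≤ z) : volume.real (E ∩ Set.Ioc x y) + volume.real (E ∩ Set.Ioc y z) ≤
      volume.real (E ∩ Set.Ioc x z) := by
  have hfin : ∀ u v, volume (E ∩ Set.Ioc u v) ≠ ⊤ := fun u v =>
    ((measure_mono Set.inter_subset_right).trans_lt measure_Ioc_lt_top).ne
  rw [← measureReal_union ?_ (hE.inter measurableSet_Ioc) (hfin x y) (hfin y z),
    ← Set.inter_union_distrib_left, Set.Ioc_union_Ioc_eq_Ioc hxy hyz]
  exact (Set.Ioc_disjoint_Ioc_of_le le_rfl).mono Set.inter_subset_right Set.inter_subset_right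

lemma measurable_genPoly {d : ℕ} (β b : Fin d → ℝ) (l : ℕ) : Measurable (genPoly β b l) := by
  unfold genPoly
  fun_prop

lemma exists_volume_genPoly_sublevel_le {d : ℕ} (β : Fin d → ℝ) (hβ : Function.Injective β)
    {c₀ C₀ : ℝ} (hc₀ : 0 < c₀) (hC₀ : 0 < C₀) :
    ∃ c C : ℝ, 0 < c ∧ 0 < C ∧ ∀ b : Fin d → ℝ, c₀ ≤ ∑ k, |b k| → ∑ k, |b k| ≤ C₀ →
      ∀ w : ℝ, 0 < w → w ≤ 1 →
        volume.real ({t | |genPoly β b 0 t| ≤ c * w ^ d} ∩ Set.Ioc (1 / 4) 4) ≤ C * w := by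
  obtain ⟨M, hM, hbound⟩ := exists_genPoly_le β (d + 1)
  obtain ⟨D, hD, hcoef⟩ := exists_sum_abs_le_of_genPoly_le β hβ
  set η : ℝ := c₀ / (2 * D) with hη
  have hη0 : 0 < η := by positivity
  set r : ℝ := η / (2 * (M * C₀)) with hr
  have hr0 : 0 < r := by positivity
  refine ⟨η / (2 * 2 ^ d), ((4 - 1 / 4) / r + 1) * (2 * 2 ^ d), by positivity, by positivity,
    fun b hb hb' w hw hw1 => ?_⟩
  have h := le_add_mul_of_short_intervals (a := 1 / 4) (b := 4) (κ := 2 * 2 ^ d * w)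
    (F := fun x y => volume.real ({t | |genPoly β b 0 t| ≤ η / (2 * 2 ^ d) * w ^ d} ∩ Set.Ioc x y))
    (G := fun _ _ => 0) hr0 (by positivity) (by norm_num)
    (fun x y z _ _ _ _ => volume_real_inter_Ioc_le _ x y z) (fun _ _ _ _ _ _ _ => by simp)
    (fun x y hx hxy hy hxyr => ?_)
  · refine h.trans (le_of_eq ?_)
    ring
  · have hsub : Set.Icc x y ⊆ Set.Icc (1 / 4) 4 := Set.Icc_subset_Icc hx hy
    rw [zero_add]
    refine volume_sublevel_le (F := genPoly β b) (M := M * C₀) hw (by linarith) (by positivity)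
      (fun i _ t ht => hasDerivAt_genPoly β b i (by linarith [(hsub ht).1]))
      (fun i hi t ht => (hbound b (i + 1) (by omega) t (hsub ht)).trans (by gcongr)) ?_
    have hx' : x ∈ Set.Icc x y := ⟨le_rfl, hxy⟩
    have hlarge : ∃ l ≤ d, η < |genPoly β b l x| := by
      by_contra! hcon
      have := hcoef b η hη0.le x (hsub hx') hcon
      have h2 : D * η = c₀ / 2 := by rw [hη]; field_simp
      linarith
    obtain ⟨l, hl, hlt⟩ := hlarge
    refine ⟨x, hx', l, hl, lt_of_le_of_lt ?_ hlt⟩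
    have e1 : (2 / w) ^ d * (η / (2 * 2 ^ d) * w ^ d) = η / 2 := by
      rw [div_pow]; field_simp
    have e2 : M * C₀ * (y - x) ≤ η / 2 := by
      calc M * C₀ * (y - x) ≤ M * C₀ * r := by gcongr
        _ = η / 2 := by rw [hr]; field_simp
    linarith

/-- For most `t` the polynomial `u ↦ ∑ j, c j * u ^ j * A⁽ʲ⁾(t)` has a large constant coefficient
`c 0 * A t`, hence it is large for most `u`. The set of exceptions is measured here in the
coordinates `(s, t)` with `u = t - s`. -/
lemma exists_lintegral_volume_euler_sublevel_le {d : ℕ} (β : Fin d → ℝ)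
    (hβ : Function.Injective β) (c : ℕ → ℝ) (hc : c 0 ≠ 0)
    {c₀ C₀ : ℝ} (hc₀ : 0 < c₀) (hC₀ : 0 < C₀) :
    ∃ e C : ℝ, 0 < e ∧ e ≤ 1 ∧ 0 < C ∧ ∀ b : Fin d → ℝ, c₀ ≤ ∑ k, |b k| → ∑ k, |b k| ≤ C₀ →
      ∀ w : ℝ, 0 < w → w ≤ 1 →
        ∫⁻ s, volume {t | t ∈ Set.Ioc (1 / 4 : ℝ) 4 ∧ t - s ∈ Set.Icc (1 / 4 : ℝ) 4 ∧
          |∑ j ∈ Finset.range (d + 1), c j * (t - s) ^ j * genPoly β b j t| ≤ e * w ^ (2 * d)} ≤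
            ENNReal.ofReal (C * w) := by
  obtain ⟨e₁, C₁, he₁, hC₁, h₁⟩ := exists_volume_genPoly_sublevel_le β hβ hc₀ hC₀
  have hc' : 0 < |c 0| := abs_pos.2 hc
  set e : ℝ := min 1 (|c 0| * e₁ / ((d + 1) * 4 ^ d)) with he
  have he0 : 0 < e := lt_min one_pos (by positivity)
  refine ⟨e, 4 * C₁ + 4 * (2 * d), he0, min_le_left _ _, by positivity,
    fun b hb hb' w hw hw1 => ?_⟩
  set D : Set (ℝ × ℝ) := {p | p.2 ∈ Set.Ioc (1 / 4 : ℝ) 4 ∧ p.2 - p.1 ∈ Set.Icc (1 / 4 : ℝ) 4 ∧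
    |∑ j ∈ Finset.range (d + 1), c j * (p.2 - p.1) ^ j * genPoly β b j p.2| ≤ e * w ^ (2 * d)}
    with hD
  have hmeas : MeasurableSet D := by
    have hf : Measurable fun p : ℝ × ℝ =>
        ∑ j ∈ Finset.range (d + 1), c j * (p.2 - p.1) ^ j * genPoly β b j p.2 :=
      Finset.measurable_sum _ fun j _ =>
        (((measurable_snd.sub measurable_fst).pow_const j).const_mul _).mul
          ((measurable_genPoly β b j).comp measurable_snd)
    exact (measurable_snd measurableSet_Ioc).inter
      (((measurable_snd.sub measurable_fst) measurableSet_Icc).inter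
        (measurableSet_le hf.abs measurable_const))
  set E : Set ℝ := {t | |genPoly β b 0 t| ≤ e₁ * w ^ d} with hE
  have hEm : MeasurableSet E := measurableSet_le (measurable_genPoly β b 0).abs measurable_const
  have hinner : ∀ t, volume ((fun s => (s, t)) ⁻¹' D) ≤
      (E ∩ Set.Ioc (1 / 4) 4).indicator (fun _ => 4) t +
        (Set.Ioc (1 / 4 : ℝ) 4).indicator (fun _ => ENNReal.ofReal (2 * d * w)) t := by
    intro t
    by_cases ht : t ∈ Set.Ioc (1 / 4 : ℝ) 4
    swap
    · have : (fun s => (s, t)) ⁻¹' D = ∅ := by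
        ext s; simp only [hD, Set.mem_preimage, Set.mem_ofPred_eq, Set.mem_empty_iff_false,
          iff_false]; exact fun h => ht h.1
      rw [this]; simp
    set U : Set ℝ := {u | u ∈ Set.Icc (1 / 4 : ℝ) 4 ∧
      |∑ j ∈ Finset.range (d + 1), (c j * genPoly β b j t) * u ^ j| ≤ e * w ^ (2 * d)} with hU
    have hUm : MeasurableSet U := by
      have hf : Measurable fun u : ℝ =>
          ∑ j ∈ Finset.range (d + 1), (c j * genPoly β b j t) * u ^ j := by fun_prop
      exact measurableSet_Icc.inter (measurableSet_le hf.abs measurable_const)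
    have hpre : (fun s => (s, t)) ⁻¹' D = (fun s => t - s) ⁻¹' U := by
      ext s
      have : ∀ j, c j * (t - s) ^ j * genPoly β b j t = c j * genPoly β b j t * (t - s) ^ j :=
        fun j => by ring
      simp only [hD, hU, Set.mem_preimage, Set.mem_ofPred_eq, this, ht, true_and]
    rw [hpre, (Measure.measurePreserving_sub_left volume t).measure_preimage hUm.nullMeasurableSet,
      Set.indicator_of_mem ht]
    by_cases htE : t ∈ E
    · rw [Set.indicator_of_mem (show t ∈ E ∩ Set.Ioc (1 / 4) 4 from ⟨htE, ht⟩)]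
      refine le_trans ?_ le_self_add
      refine (measure_mono (t := Set.Icc (1 / 4) 4) fun u hu => hu.1).trans ?_
      rw [Real.volume_Icc, ENNReal.ofReal_le_iff_le_toReal (by simp)]
      norm_num
    · rw [Set.indicator_of_notMem (fun h => htE h.1), zero_add]
      refine volume_sublevel_polynomial_le _ hw ?_
      have htE' : e₁ * w ^ d < |genPoly β b 0 t| := not_le.1 htE
      rw [abs_mul]
      refine lt_of_le_of_lt ?_ (mul_lt_mul_of_pos_left htE' hc')
      have h2 : e ≤ |c 0| * e₁ / ((d + 1) * 4 ^ d) := min_le_right _ _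
      calc (d + 1 : ℝ) * (4 / w) ^ d * (e * w ^ (2 * d))
          ≤ (d + 1) * (4 / w) ^ d * (|c 0| * e₁ / ((d + 1) * 4 ^ d) * w ^ (2 * d)) := by gcongr
        _ = |c 0| * (e₁ * w ^ d) := by
          rw [div_pow, two_mul, pow_add]; field_simp
  have hprod : ∫⁻ s, volume {t | t ∈ Set.Ioc (1 / 4 : ℝ) 4 ∧ t - s ∈ Set.Icc (1 / 4 : ℝ) 4 ∧
          |∑ j ∈ Finset.range (d + 1), c j * (t - s) ^ j * genPoly β b j t| ≤ e * w ^ (2 * d)} =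
      ∫⁻ t, volume ((fun s => (s, t)) ⁻¹' D) := by
    rw [← Measure.prod_apply_symm hmeas, Measure.prod_apply hmeas]
    rfl
  rw [hprod]
  refine (lintegral_mono hinner).trans ?_
  rw [lintegral_add_left (measurable_const.indicator (hEm.inter measurableSet_Ioc)),
    lintegral_indicator_const (hEm.inter measurableSet_Ioc),
    lintegral_indicator_const measurableSet_Ioc, Real.volume_Ioc]
  have h3 : volume (E ∩ Set.Ioc (1 / 4) 4) ≤ ENNReal.ofReal (C₁ * w) := by
    rw [ENNReal.le_ofReal_iff_toReal_le _ (by positivity)]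
    · exact h₁ b hb hb' w hw hw1
    · exact ((measure_mono Set.inter_subset_right).trans_lt measure_Ioc_lt_top).ne
  have h4 : (4 : ENNReal) = ENNReal.ofReal 4 := by simp
  calc _ ≤ ENNReal.ofReal 4 * ENNReal.ofReal (C₁ * w) +
        ENNReal.ofReal (2 * d * w) * ENNReal.ofReal 4 := by
        rw [h4]
        gcongr
        norm_num
    _ = ENNReal.ofReal ((4 * C₁ + 4 * (2 * d)) * w) := by
        rw [← ENNReal.ofReal_mul (by norm_num), ← ENNReal.ofReal_mul (by positivity),
          ← ENNReal.ofReal_add (by positivity) (by positivity)]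
        congr 1; ring

/-- The difference `A t - B (t - s)` is small only where the Euler form of `A` is small, up to a
small set. The Euler operator in `u = t - s` annihilates `B`, so it turns the difference into the
Euler form of `A`, and a large value of the latter forces a large derivative of the difference. -/
lemma exists_volume_sub_sublevel_le {d : ℕ} (β : Fin d → ℝ) (c : ℕ → ℝ)
    (hc : ∀ x : ℝ, ∑ j ∈ Finset.range (d + 1), c j * (descPochhammer ℝ j).eval x =
      ∏ k, (x - β k)) {C₀ : ℝ} (hC₀ : 0 < C₀) :
    ∃ e C : ℝ, 0 < e ∧ 0 < C ∧ ∀ a b : Fin d → ℝ, ∑ k, |a k| ≤ C₀ → ∑ k, |b k| ≤ C₀ →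
      ∀ s x y : ℝ, x ≤ y → Set.Icc x y ⊆ Set.Icc (1 / 4) 4 →
      (∀ t ∈ Set.Icc x y, t - s ∈ Set.Icc (1 / 4 : ℝ) 4) →
      ∀ w ν : ℝ, 0 < w → w ≤ 1 → 0 < ν → ν ≤ 1 →
        volume.real ({t | |genPoly β a 0 t - genPoly β b 0 (t - s)| ≤ e * (w * ν) ^ d * ν} ∩
            Set.Ioc x y) ≤
          volume.real ({t | |∑ j ∈ Finset.range (d + 1), c j * (t - s) ^ j * genPoly β a j t| ≤ ν} ∩
            Set.Ioc x y) + C * w := by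
  obtain ⟨M, hM, hbound⟩ := exists_genPoly_le β (d + 1)
  set H : ℝ := 1 + ∑ j ∈ Finset.range (d + 1), |c j| * 4 ^ j with hH
  have hH0 : 0 < H := by positivity
  set M' : ℝ := M * C₀ + M * C₀ with hM'
  have hM'0 : 0 < M' := by positivity
  refine ⟨1 / (2 * H * 2 ^ d), (8 * H * M' + 1) * (2 * 2 ^ d), by positivity, by positivity,
    fun a b ha hb s x y hxy hI hJ w ν hw hw1 hν hν1 => ?_⟩
  set g : ℕ → ℝ → ℝ := fun l t => genPoly β a l t - genPoly β b l (t - s) with hg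
  set S : Set ℝ := {t | |∑ j ∈ Finset.range (d + 1), c j * (t - s) ^ j * genPoly β a j t| ≤ ν}
    with hS
  have hSm : MeasurableSet S := by
    refine measurableSet_le (Measurable.abs (Finset.measurable_sum _ fun j _ => ?_))
      measurable_const
    exact (((measurable_id.sub_const s).pow_const j).const_mul _).mul (measurable_genPoly β a j)
  have hlarge : ∀ t ∈ Set.Icc x y, t ∉ S → ∃ l ≤ d, ν / H < |g l t| := by
    intro t ht htS
    by_contra! hcon
    refine htS ?_
    have hu := hJ t ht
    have hu0 : 0 < t - s := by linarith [hu.1]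
    have hB := sum_mul_pow_mul_genPoly β b c (d + 1) hu0
    simp only [hc] at hB
    rw [Finset.sum_eq_zero (s := Finset.univ) (fun k _ => by
      rw [Finset.prod_eq_zero (Finset.mem_univ k) (sub_self _)]; simp)] at hB
    have heq : ∑ j ∈ Finset.range (d + 1), c j * (t - s) ^ j * genPoly β a j t =
        ∑ j ∈ Finset.range (d + 1), c j * (t - s) ^ j * g j t := by
      simp only [hg, mul_sub, Finset.sum_sub_distrib]
      rw [hB, sub_zero]
    rw [hS, Set.mem_ofPred_eq, heq]
    calc _ ≤ ∑ j ∈ Finset.range (d + 1), |c j| * 4 ^ j * (ν / H) := by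
          refine (Finset.abs_sum_le_sum_abs _ _).trans (Finset.sum_le_sum fun j hj => ?_)
          rw [abs_mul, abs_mul, abs_of_nonneg (pow_nonneg hu0.le j)]
          gcongr
          · exact hu.2
          · exact hcon j (by have := Finset.mem_range.1 hj; omega)
      _ = (H - 1) * (ν / H) := by rw [← Finset.sum_mul, hH]; ring
      _ ≤ H * (ν / H) := by gcongr; linarith
      _ = ν := by field_simp
  set r : ℝ := ν / (2 * H * M') with hr
  have hr0 : 0 < r := by positivity
  have h := le_add_mul_of_short_intervals (a := x) (b := y) (κ := 2 * 2 ^ d * (w * ν))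
    (F := fun x y => volume.real ({t | |g 0 t| ≤ 1 / (2 * H * 2 ^ d) * (w * ν) ^ d * ν} ∩
      Set.Ioc x y))
    (G := fun x y => volume.real (S ∩ Set.Ioc x y)) hr0 (by positivity) hxy
    (fun x y z _ _ _ _ => volume_real_inter_Ioc_le _ x y z)
    (fun x y z _ hxy hyz _ => volume_real_inter_Ioc_add hSm hxy hyz)
    (fun x' y' hx hxy' hy hxyr => ?_)
  · refine h.trans (add_le_add_right ?_ _)
    have hyx : y - x ≤ 4 := by
      have h1 := (hI ⟨le_rfl, hxy⟩).1
      have h2 := (hI ⟨hxy, le_rfl⟩).2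
      linarith
    calc ((y - x) / r + 1) * (2 * 2 ^ d * (w * ν))
        ≤ (4 / r + 1) * (2 * 2 ^ d * (w * ν)) := by gcongr
      _ = (8 * H * M' + ν) * (2 * 2 ^ d) * w := by rw [hr]; field_simp; ring
      _ ≤ _ := by gcongr
  · have hsub : Set.Icc x' y' ⊆ Set.Icc x y := Set.Icc_subset_Icc hx hy
    by_cases hgood : ∃ t ∈ Set.Ioc x' y', t ∉ S
    · obtain ⟨t, ht, htS⟩ := hgood
      obtain ⟨l, hl, hlt⟩ := hlarge t (hsub (Set.Ioc_subset_Icc_self ht)) htS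
      refine (volume_sublevel_le (F := g) (M := M') (τ := w * ν) (k := d) (by positivity)
        (by nlinarith) (by positivity) (fun i _ z hz => ?_) (fun i hi z hz => ?_)
        ⟨t, Set.Ioc_subset_Icc_self ht, l, hl, lt_of_le_of_lt ?_ hlt⟩).trans
          (le_add_of_nonneg_left measureReal_nonneg)
      · have h1 := (hI (hsub hz)).1
        have h2 := (hJ z (hsub hz)).1
        refine (hasDerivAt_genPoly β a i (by linarith)).sub ?_
        exact (hasDerivAt_genPoly β b i (by linarith)).comp_sub_const z s
      · refine (abs_sub _ _).trans (add_le_add ?_ ?_)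
        · exact (hbound a (i + 1) (by omega) z (hI (hsub hz))).trans (by gcongr)
        · exact (hbound b (i + 1) (by omega) _ (hJ z (hsub hz))).trans (by gcongr)
      · have e1 : (2 / (w * ν)) ^ d * (1 / (2 * H * 2 ^ d) * (w * ν) ^ d * ν) = ν / H / 2 := by
          rw [div_pow]; field_simp
        have e2 : M' * (y' - x') ≤ ν / H / 2 := by
          calc M' * (y' - x') ≤ M' * r := by gcongr
            _ = _ := by rw [hr]; field_simp
        linarith
    · push Not at hgood
      have hfin : volume (S ∩ Set.Ioc x' y') ≠ ⊤ :=
        ((measure_mono Set.inter_subset_right).trans_lt measure_Ioc_lt_top).ne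
      exact le_trans (measureReal_mono
        (Set.subset_inter (fun z hz => hgood z hz.2) Set.inter_subset_right) hfin)
        (le_add_of_nonneg_right (by positivity))

/-- An oscillatory integral whose phase has second derivative `N * g` is controlled by the measure
of a sublevel set of `g`: on short intervals that leave the sublevel set, `|g|` stays large and the
second derivative test applies. -/
lemma norm_integral_exp_le_volume_sublevel {Φ Φ₁ g g₁ ψ ψ₁ : ℝ → ℝ} {a b A δ μ M N : ℝ}
    (hab : a ≤ b) (hδ : 0 < δ) (hμ : 0 < μ) (hM : 0 < M) (hN : δ ^ 2 = N * (μ / 2))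
    (hΦ : ∀ t ∈ Set.Icc a b, HasDerivAt Φ (Φ₁ t) t)
    (hΦ₁ : ∀ t ∈ Set.Icc a b, HasDerivAt Φ₁ (N * g t) t)
    (hg : ∀ t ∈ Set.Icc a b, HasDerivAt g (g₁ t) t)
    (hg₁ : ∀ t ∈ Set.Icc a b, |g₁ t| ≤ M) (hgm : Measurable g)
    (hψ : ∀ t ∈ Set.Icc a b, HasDerivAt ψ (ψ₁ t) t)
    (hψ₁ : ContinuousOn ψ₁ (Set.Icc a b))
    (hA : ∀ t ∈ Set.Icc a b, |ψ t| ≤ A) (hA₁ : ∀ t ∈ Set.Icc a b, |ψ₁ t| ≤ A) :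
    ‖∫ t in a..b, Complex.exp (Complex.I * (Φ t : ℂ)) * (ψ t : ℂ)‖ ≤
      A * volume.real ({t | |g t| ≤ μ} ∩ Set.Ioc a b) +
        (2 * M * (b - a) / μ + 1) * (A * (10 + 2 * (b - a)) / δ) := by
  have hA0 : 0 ≤ A := (abs_nonneg _).trans (hA a ⟨le_rfl, hab⟩)
  have hba : 0 ≤ b - a := by linarith
  have hN0 : 0 ≤ N := by
    by_contra! h
    nlinarith [sq_nonneg δ, mul_pos (neg_pos.2 h) hμ, pow_pos hδ 2]
  have hcΦ : ContinuousOn Φ (Set.Icc a b) := fun t ht => (hΦ t ht).continuousAt.continuousWithinAt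
  have hcψ : ContinuousOn ψ (Set.Icc a b) := fun t ht => (hψ t ht).continuousAt.continuousWithinAt
  have hcg : ContinuousOn g (Set.Icc a b) := fun t ht => (hg t ht).continuousAt.continuousWithinAt
  have hcont : ContinuousOn (fun t => Complex.exp (Complex.I * (Φ t : ℂ)) * (ψ t : ℂ))
      (Set.Icc a b) :=
    (continuousOn_const.mul (Complex.continuous_ofReal.comp_continuousOn hcΦ)).cexp.mul
      (Complex.continuous_ofReal.comp_continuousOn hcψ)
  have hii : ∀ u v, a ≤ u → u ≤ v → v ≤ b → IntervalIntegrable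
      (fun t => Complex.exp (Complex.I * (Φ t : ℂ)) * (ψ t : ℂ)) volume u v := fun u v h1 h2 h3 =>
    ContinuousOn.intervalIntegrable (by
      rw [Set.uIcc_of_le h2]
      exact hcont.mono (Set.Icc_subset_Icc h1 h3))
  have hEm : MeasurableSet {t | |g t| ≤ μ} := measurableSet_le hgm.abs measurable_const
  have h := le_add_mul_of_short_intervals (a := a) (b := b) (r := μ / (2 * M))
    (κ := A * (10 + 2 * (b - a)) / δ)
    (F := fun x y => ‖∫ t in x..y, Complex.exp (Complex.I * (Φ t : ℂ)) * (ψ t : ℂ)‖)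
    (G := fun x y => A * volume.real ({t | |g t| ≤ μ} ∩ Set.Ioc x y)) (by positivity)
    (by positivity) hab
    (fun x y z hx hxy hyz hz => ?_)
    (fun x y z _ hxy hyz _ => by
      rw [← mul_add]
      exact mul_le_mul_of_nonneg_left (volume_real_inter_Ioc_add hEm hxy hyz) hA0)
    (fun x y hx hxy hy hxyr => ?_)
  · refine h.trans (le_of_eq ?_)
    congr 3
    field_simp
  · rw [← intervalIntegral.integral_add_adjacent_intervals (hii x y hx hxy (hyz.trans hz))
      (hii y z (hx.trans hxy) hyz hz)]
    exact norm_add_le _ _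
  · have hsub : Set.Icc x y ⊆ Set.Icc a b := Set.Icc_subset_Icc hx hy
    by_cases hgood : ∃ t ∈ Set.Ioc x y, μ < |g t|
    · obtain ⟨t, ht, hlt⟩ := hgood
      have hlow : ∀ z ∈ Set.Icc x y, μ / 2 ≤ |g z| := by
        intro z hz
        have hd := (convex_Icc x y).norm_image_sub_le_of_norm_hasDerivWithin_le
          (fun z hz => (hg z (hsub hz)).hasDerivWithinAt) (fun z hz => hg₁ z (hsub hz))
          hz (Set.Ioc_subset_Icc_self ht)
        rw [Real.norm_eq_abs, Real.norm_eq_abs] at hd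
        have h1 : |t - z| ≤ μ / (2 * M) := (abs_sub_le_iff.2
          ⟨by linarith [ht.2, hz.1], by linarith [hz.2, ht.1]⟩).trans hxyr
        have h2 : M * |t - z| ≤ μ / 2 := by
          calc M * |t - z| ≤ M * (μ / (2 * M)) := by gcongr
            _ = μ / 2 := by field_simp
        have h3 := abs_sub_abs_le_abs_sub (g t) (g z)
        linarith
      refine (norm_integral_exp_le_of_deriv2_ge hxy hδ (fun z hz => hΦ z (hsub hz))
        (fun z hz => hΦ₁ z (hsub hz)) (continuousOn_const.mul (hcg.mono hsub))
        (fun z hz => hψ z (hsub hz)) (hψ₁.mono hsub) (fun z hz => hA z (hsub hz))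
        (fun z hz => hA₁ z (hsub hz)) (fun z hz => ?_)).trans ?_
      · rw [abs_mul, abs_of_nonneg hN0, hN]
        exact mul_le_mul_of_nonneg_left (hlow z hz) hN0
      · refine le_trans ?_ (le_add_of_nonneg_left (mul_nonneg hA0 measureReal_nonneg))
        gcongr
    · push Not at hgood
      have hE : {t | |g t| ≤ μ} ∩ Set.Ioc x y = Set.Ioc x y :=
        Set.inter_eq_right.2 fun z hz => hgood z hz
      rw [hE, Real.volume_real_Ioc_of_le hxy]
      refine le_trans ?_ (le_add_of_nonneg_right (by positivity))
      refine (intervalIntegral.norm_integral_le_of_norm_le_const (C := A) fun t ht => ?_).trans ?_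
      · rw [Set.uIoc_of_le hxy] at ht
        rw [norm_mul, mul_comm Complex.I, Complex.norm_exp_ofReal_mul_I, one_mul, Complex.norm_real]
        exact hA t (hsub (Set.Ioc_subset_Icc_self ht))
      · rw [abs_of_nonneg (by linarith)]

lemma genPoly_two {d : ℕ} (α a : Fin d → ℝ) (t : ℝ) :
    genPoly α a 2 t =
      genPoly (fun k => α k - 2) (fun k => a k * (descPochhammer ℝ 2).eval (α k)) 0 t := by
  unfold genPoly
  refine Finset.sum_congr rfl fun k _ => ?_
  simp [mul_assoc]

/-- The set of integration in the `TT*` kernel: both `t` and `t - s` lie in `(1/4, 4]`. -/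
def overlap (s : ℝ) : Set ℝ := Set.Ioc (max (1 / 4) (1 / 4 + s)) (min 4 (4 + s))

set_option maxHeartbeats 1000000 in
/-- Integrated in `s`, the oscillatory integrals of the `TT*` kernel are small, although the
coefficients `b₀`, `b` of the second curve may depend on `s` in an arbitrary way. The size `N` of
the nonlinear part is a negative power of the gain `w`. -/
lemma exists_kernel_majorant {d : ℕ} (α : Fin d → ℝ) (hα : ∀ k, 0 < α k ∧ α k ≠ 1 ∧ α k ≠ 2)
    (hinj : Function.Injective α) (ψ : ℝ → ℝ) (hψ : ContDiff ℝ 1 ψ) :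
    ∃ K : ℝ, 0 < K ∧ ∀ w N : ℝ, 0 < w → w ≤ 1 → N * w ^ (2 * (3 * (d ^ 2 + 2 * d) + 1)) = 1 →
      ∀ (a₀ : ℝ) (a : Fin d → ℝ), 1 / 4 ≤ ∑ k, |a k| → ∑ k, |a k| ≤ 4 →
      ∃ H : ℝ → ENNReal, ∫⁻ s, H s ≤ ENNReal.ofReal (K * w) ∧
        ∀ (s b₀ : ℝ) (b : Fin d → ℝ), ∑ k, |b k| ≤ 4 →
          ‖∫ t in overlap s, Complex.exp (Complex.I * ((a₀ * t + N * genPoly α a 0 t -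
            (b₀ * (t - s) + N * genPoly α b 0 (t - s)) : ℝ) : ℂ)) *
              ((ψ t * ψ (t - s) : ℝ) : ℂ)‖ₑ ≤ H s := by
  -- twice `Q` is at least the exponent `2 d ^ 2 + 3 d` of `w` in the sublevel threshold below
  set Q : ℕ := d ^ 2 + 2 * d with hQ
  set β : Fin d → ℝ := fun k => α k - 2 with hβ
  have hβinj : Function.Injective β := fun i j hij => hinj (sub_left_injective hij)
  -- size of the coefficients `α (α - 1)` created by two derivatives
  set v : Fin d → ℝ := fun k => (descPochhammer ℝ 2).eval (α k) with hv
  have hv0 : ∀ k, v k ≠ 0 := fun k => by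
    have h : v k = α k * (α k - 1) := by simp [hv, descPochhammer_succ_eval]
    rw [h]
    exact mul_ne_zero (hα k).1.ne' (sub_ne_zero.2 (hα k).2.1)
  set S : ℝ := 1 + ∑ k, |v k|⁻¹ with hS
  set V : ℝ := 1 + ∑ k, |v k| with hV
  have hS0 : 0 < S := by positivity
  have hV0 : 0 < V := by positivity
  have hlow : ∀ a : Fin d → ℝ, 1 / 4 ≤ ∑ k, |a k| → 1 / (4 * S) ≤ ∑ k, |a k * v k| := by
    intro a ha
    have h1 : ∑ k, |a k| ≤ S * ∑ k, |a k * v k| := by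
      rw [Finset.mul_sum]
      refine Finset.sum_le_sum fun k _ => ?_
      have h2 : |v k|⁻¹ ≤ S := by
        have := Finset.single_le_sum (f := fun k => |v k|⁻¹) (fun k _ => by positivity)
          (Finset.mem_univ k)
        linarith
      have h3 : |v k| ≠ 0 := abs_ne_zero.2 (hv0 k)
      calc |a k| = |v k|⁻¹ * |a k * v k| := by rw [abs_mul]; field_simp
        _ ≤ _ := by gcongr
    rw [div_le_iff₀ (by positivity)]
    linarith
  have hupp : ∀ a : Fin d → ℝ, ∑ k, |a k| ≤ 4 → ∑ k, |a k * v k| ≤ 4 * V := by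
    intro a ha
    calc ∑ k, |a k * v k| ≤ ∑ k, |a k| * V := by
          refine Finset.sum_le_sum fun k _ => ?_
          rw [abs_mul]
          gcongr
          have := Finset.single_le_sum (f := fun k => |v k|) (fun k _ => abs_nonneg _)
            (Finset.mem_univ k)
          linarith
      _ = (∑ k, |a k|) * V := by rw [Finset.sum_mul]
      _ ≤ _ := by gcongr
  obtain ⟨c, -, hc⟩ := exists_newton_expansion β Finset.univ
  -- this is where the exponent `2` has to be excluded
  have hc0 : c 0 ≠ 0 := by
    have h := hc 0
    rw [Finset.sum_eq_single 0 (fun j _ hj => by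
      rw [descPochhammer_ne_zero_eval_zero _ hj, mul_zero]) (by simp)] at h
    simp only [descPochhammer_zero, Polynomial.eval_one, mul_one] at h
    rw [h]
    refine Finset.prod_ne_zero_iff.2 fun k _ => ?_
    rw [zero_sub, neg_ne_zero]
    exact sub_ne_zero.2 (hα k).2.2
  obtain ⟨e, C₁, he, he1, hC₁, h₁⟩ := exists_lintegral_volume_euler_sublevel_le β hβinj c hc0
    (c₀ := 1 / (4 * S)) (C₀ := 4 * V) (by positivity) (by positivity)
  obtain ⟨e', C₂, he', hC₂, h₂⟩ := exists_volume_sub_sublevel_le β c hc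
    (C₀ := 4 * V) (by positivity)
  obtain ⟨M, hM, hbound⟩ := exists_genPoly_le β 1
  set M' : ℝ := M * (4 * V) + M * (4 * V) with hM'
  have hM'0 : 0 < M' := by positivity
  -- bounds for the amplitude
  obtain ⟨A₀, hA₀⟩ := (isCompact_Icc (a := (1 / 4 : ℝ)) (b := 4)).exists_bound_of_continuousOn
    hψ.continuous.continuousOn
  obtain ⟨A₁, hA₁⟩ := (isCompact_Icc (a := (1 / 4 : ℝ)) (b := 4)).exists_bound_of_continuousOn
    (hψ.continuous_deriv le_rfl).continuousOn
  simp only [Real.norm_eq_abs] at hA₀ hA₁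
  set B : ℝ := 1 + |A₀| + |A₁| with hB
  have hB0 : 0 < B := by positivity
  have hBψ : ∀ t ∈ Set.Icc (1 / 4 : ℝ) 4, |ψ t| ≤ B := fun t ht => by
    have := hA₀ t ht; have := le_abs_self A₀; have := abs_nonneg A₁; linarith
  have hBψ' : ∀ t ∈ Set.Icc (1 / 4 : ℝ) 4, |deriv ψ t| ≤ B := fun t ht => by
    have := hA₁ t ht; have := le_abs_self A₁; have := abs_nonneg A₀; linarith
  set A : ℝ := B * B + B * B with hA
  have hA0 : 0 < A := by positivity
  set κ : ℝ := Real.sqrt (e' * e ^ (d + 1) / 2) with hκ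
  have hκ0 : 0 < κ := Real.sqrt_pos.2 (by positivity)
  have hκ2 : 2 * κ ^ 2 = e' * e ^ (d + 1) := by
    rw [hκ, Real.sq_sqrt (by positivity)]; ring
  set R : ℝ := A * C₂ + (4 * M' / κ ^ 2 + 1) * (18 * A / κ) with hR
  have hR0 : 0 < R := by positivity
  refine ⟨A * C₁ + R * 8, by positivity, fun w N hw hw1 hN a₀ a ha hau => ?_⟩
  set a' : Fin d → ℝ := fun k => a k * v k with ha'
  set X : ℝ → Set ℝ := fun s => {t | t ∈ Set.Ioc (1 / 4 : ℝ) 4 ∧ t - s ∈ Set.Icc (1 / 4 : ℝ) 4 ∧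
    |∑ j ∈ Finset.range (d + 1), c j * (t - s) ^ j * genPoly β a' j t| ≤ e * w ^ (2 * d)} with hX
  refine ⟨fun s => ENNReal.ofReal A * volume (X s) +
    (Set.Icc (-4 : ℝ) 4).indicator (fun _ => ENNReal.ofReal (R * w)) s, ?_, ?_⟩
  · rw [lintegral_add_right _ (measurable_const.indicator measurableSet_Icc),
      lintegral_const_mul' _ _ ENNReal.ofReal_ne_top, lintegral_indicator_const measurableSet_Icc,
      Real.volume_Icc]
    have h := h₁ a' (hlow a ha) (hupp a hau) w hw hw1
    calc _ ≤ ENNReal.ofReal A * ENNReal.ofReal (C₁ * w) +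
          ENNReal.ofReal (R * w) * ENNReal.ofReal (4 - -4) := by gcongr
      _ = ENNReal.ofReal ((A * C₁ + R * 8) * w) := by
        rw [← ENNReal.ofReal_mul (by positivity), ← ENNReal.ofReal_mul (by positivity),
          ← ENNReal.ofReal_add (by positivity) (by positivity)]
        congr 1; ring
  · intro s b₀ b hb
    unfold overlap
    beta_reduce
    set x : ℝ := max (1 / 4) (1 / 4 + s) with hx
    set y : ℝ := min 4 (4 + s) with hy
    rcases le_or_gt y x with hyx | hxy
    · rw [Set.Ioc_eq_empty (not_lt.2 hyx)]
      simp
    have hx1 : 1 / 4 ≤ x := le_max_left _ _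
    have hx2 : 1 / 4 + s ≤ x := le_max_right _ _
    have hy1 : y ≤ 4 := min_le_left _ _
    have hy2 : y ≤ 4 + s := min_le_right _ _
    have hs : s ∈ Set.Icc (-4 : ℝ) 4 := ⟨by linarith, by linarith⟩
    have hI : Set.Icc x y ⊆ Set.Icc (1 / 4) 4 := Set.Icc_subset_Icc hx1 hy1
    have hJ : ∀ t ∈ Set.Icc x y, t - s ∈ Set.Icc (1 / 4 : ℝ) 4 := fun t ht =>
      ⟨by linarith [ht.1], by linarith [ht.2]⟩
    set b' : Fin d → ℝ := fun k => b k * v k with hb'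
    rw [Set.indicator_of_mem hs, ← intervalIntegral.integral_of_le hxy.le]
    set ν : ℝ := e * w ^ (2 * d) with hν
    have hν0 : 0 < ν := by positivity
    have hν1 : ν ≤ 1 := mul_le_one₀ he1 (by positivity) (pow_le_one₀ hw.le hw1)
    set μ : ℝ := 2 * κ ^ 2 * w ^ (2 * Q) with hμ
    have hμ0 : 0 < μ := by positivity
    set P : ℕ := 3 * Q + 1 with hP
    set δ : ℝ := κ * w ^ Q / w ^ P with hδ
    have hδ0 : 0 < δ := by positivity
    -- the exponent `P = 3 Q + 1` pays for the `w ^ (-2 Q)` short intervals of the second derivative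
    -- test and for the loss `w ^ (-Q)` in each of them, and leaves one factor `w`
    have hδN : δ ^ 2 = N * (μ / 2) := by
      have : N = 1 / w ^ (2 * P) := by rw [eq_div_iff (by positivity)]; exact hN
      rw [hδ, hμ, this, div_pow, mul_pow, ← pow_mul, ← pow_mul, mul_comm Q, mul_comm P]
      field_simp
    have hμle : μ ≤ e' * (w * ν) ^ d * ν := by
      have h1 : e' * (w * ν) ^ d * ν = 2 * κ ^ 2 * w ^ (d + 2 * d * d + 2 * d) := by
        rw [hκ2, hν, mul_pow, mul_pow, ← pow_mul, pow_add, pow_add, pow_add]; ring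
      rw [h1, hμ]
      gcongr 2 * κ ^ 2 * ?_
      refine pow_le_pow_of_le_one hw.le hw1 ?_
      rw [hQ]; nlinarith
    set g : ℝ → ℝ := fun t => genPoly β a' 0 t - genPoly β b' 0 (t - s) with hg
    have hosc := norm_integral_exp_le_volume_sublevel (a := x) (b := y) (A := A) (δ := δ) (μ := μ)
      (M := M') (N := N)
      (Φ := fun t => a₀ * t + N * genPoly α a 0 t - (b₀ * (t - s) + N * genPoly α b 0 (t - s)))
      (Φ₁ := fun t => a₀ + N * genPoly α a 1 t - (b₀ + N * genPoly α b 1 (t - s)))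
      (g := g) (g₁ := fun t => genPoly β a' 1 t - genPoly β b' 1 (t - s))
      (ψ := fun t => ψ t * ψ (t - s))
      (ψ₁ := fun t => deriv ψ t * ψ (t - s) + ψ t * deriv ψ (t - s))
      hxy.le hδ0 hμ0 hM'0 hδN
      (fun t ht => ?_) (fun t ht => ?_) (fun t ht => ?_) (fun t ht => ?_)
      ((measurable_genPoly _ _ _).sub ((measurable_genPoly _ _ _).comp (measurable_id.sub_const s)))
      (fun t ht => ?_) ?_ (fun t ht => ?_) (fun t ht => ?_)
    rotate_left
    · have h1 := (hI ht).1
      have h2 := (hJ t ht).1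
      have h3 := (hasDerivAt_genPoly α a 0 (show 0 < t by linarith)).const_mul N
      have h4 :=
        ((hasDerivAt_genPoly α b 0 (show 0 < t - s by linarith)).comp_sub_const t s).const_mul N
      have h5 := (hasDerivAt_id t).const_mul a₀
      have h6 := ((hasDerivAt_id t).sub_const s).const_mul b₀
      exact ((h5.add h3).sub (h6.add h4)).congr_deriv (by simp)
    · have h1 := (hI ht).1
      have h2 := (hJ t ht).1
      have h3 := (hasDerivAt_genPoly α a 1 (show 0 < t by linarith)).const_mul N
      have h4 :=
        ((hasDerivAt_genPoly α b 1 (show 0 < t - s by linarith)).comp_sub_const t s).const_mul N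
      refine ((h3.const_add a₀).sub (h4.const_add b₀)).congr_deriv ?_
      rw [genPoly_two, genPoly_two]
      simp only [hg, hβ, ha', hb', hv]
      ring
    · have h1 := (hI ht).1
      have h2 := (hJ t ht).1
      exact (hasDerivAt_genPoly β a' 0 (by linarith)).sub
        ((hasDerivAt_genPoly β b' 0 (by linarith)).comp_sub_const t s)
    · refine (abs_sub _ _).trans (add_le_add ?_ ?_)
      · refine (hbound a' 1 le_rfl t (hI ht)).trans ?_
        gcongr
        exact hupp a hau
      · refine (hbound b' 1 le_rfl _ (hJ t ht)).trans ?_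
        gcongr
        exact hupp b hb
    · have h1 := (hψ.differentiable (by norm_num) t).hasDerivAt
      have h2 := ((hψ.differentiable (by norm_num) (t - s)).hasDerivAt).comp_sub_const t s
      exact h1.mul h2
    · have h1 := hψ.continuous_deriv le_rfl
      have h2 := hψ.continuous
      have h3 : Continuous fun t : ℝ => t - s := continuous_id.sub continuous_const
      exact ((h1.mul (h2.comp h3)).add (h2.mul (h1.comp h3))).continuousOn
    · rw [abs_mul, hA]
      have := mul_le_mul (hBψ t (hI ht)) (hBψ _ (hJ t ht)) (abs_nonneg _) hB0.le
      have : 0 ≤ B * B := by positivity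
      linarith
    · refine (abs_add_le _ _).trans ?_
      rw [abs_mul, abs_mul]
      exact add_le_add
        (mul_le_mul (hBψ' t (hI ht)) (hBψ _ (hJ t ht)) (abs_nonneg _) hB0.le)
        (mul_le_mul (hBψ t (hI ht)) (hBψ' _ (hJ t ht)) (abs_nonneg _) hB0.le)
    have hsub := h₂ a' b' (hupp a hau) (hupp b hb) s x y hxy.le hI hJ w ν hw hw1 hν0 hν1
    have hXfin : volume (X s) ≠ ⊤ :=
      ((measure_mono (t := Set.Ioc (1 / 4 : ℝ) 4) fun t ht => ht.1).trans_lt measure_Ioc_lt_top).ne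
    have hmono1 : volume.real ({t | |g t| ≤ μ} ∩ Set.Ioc x y) ≤
        volume.real ({t | |g t| ≤ e' * (w * ν) ^ d * ν} ∩ Set.Ioc x y) :=
      measureReal_mono (Set.inter_subset_inter_left _ fun t ht => le_trans ht hμle)
        ((measure_mono Set.inter_subset_right).trans_lt measure_Ioc_lt_top).ne
    have hmono2 : volume.real ({t | |∑ j ∈ Finset.range (d + 1),
        c j * (t - s) ^ j * genPoly β a' j t| ≤ ν} ∩ Set.Ioc x y) ≤ volume.real (X s) := by
      refine measureReal_mono (fun t ht => ?_) hXfin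
      exact ⟨⟨hx1.trans_lt ht.2.1, ht.2.2.trans hy1⟩, hJ t (Set.Ioc_subset_Icc_self ht.2), ht.1⟩
    have herr : (2 * M' * (y - x) / μ + 1) * (A * (10 + 2 * (y - x)) / δ) ≤
        (4 * M' / κ ^ 2 + 1) * (18 * A / κ) * w := by
      have h4 : y - x ≤ 4 := by linarith
      have h0 : 0 ≤ y - x := by linarith
      have hw2 : w ^ (2 * Q) ≤ 1 := pow_le_one₀ hw.le hw1
      calc (2 * M' * (y - x) / μ + 1) * (A * (10 + 2 * (y - x)) / δ)
          ≤ (2 * M' * 4 / μ + 1) * (A * (10 + 2 * 4) / δ) := by gcongr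
        _ = (4 * M' / κ ^ 2 + w ^ (2 * Q)) * (18 * A / κ) * w := by
          have h5 : w ^ P = w ^ Q * w ^ (2 * Q) * w := by rw [hP]; ring
          rw [hμ, hδ, h5]
          field_simp
          ring
        _ ≤ _ := by gcongr
    have hfinal : ‖∫ t in x..y, Complex.exp (Complex.I * ((a₀ * t + N * genPoly α a 0 t -
            (b₀ * (t - s) + N * genPoly α b 0 (t - s)) : ℝ) : ℂ)) *
              ((ψ t * ψ (t - s) : ℝ) : ℂ)‖ ≤ A * volume.real (X s) + R * w := by
      refine hosc.trans ?_
      have := mul_le_mul_of_nonneg_left (hmono1.trans (hsub.trans (add_le_add_left hmono2 _)))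
        hA0.le
      rw [hR]
      linarith
    rw [← ofReal_norm]
    refine (ENNReal.ofReal_le_ofReal hfinal).trans (le_of_eq ?_)
    rw [ENNReal.ofReal_add (mul_nonneg hA0.le measureReal_nonneg) (by positivity),
      ENNReal.ofReal_mul hA0.le, ofReal_measureReal hXfin]

/-! ### The `TT*` method for integral kernels -/

section KernelBound

variable {X Y : Type*} [MeasurableSpace X] [MeasurableSpace Y] {μ : Measure X} {ν : Measure Y}

lemma ENNReal.mul_le_sq_add_sq (a b : ENNReal) : a * b ≤ a ^ 2 + b ^ 2 := by
  rcases le_total a b with h | h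
  · calc a * b ≤ b * b := by gcongr
      _ ≤ a ^ 2 + b ^ 2 := by rw [← sq]; exact le_add_self
  · calc a * b ≤ a * a := by gcongr
      _ ≤ a ^ 2 + b ^ 2 := by rw [← sq]; exact le_self_add

lemma sq_lintegral_mul_le {f g : Y → ENNReal} (hf : Measurable f) (hg : Measurable g) :
    (∫⁻ y, f y * g y ∂ν) ^ 2 ≤ (∫⁻ y, f y ^ 2 ∂ν) * ∫⁻ y, g y ^ 2 ∂ν := by
  have h := ENNReal.lintegral_mul_le_Lp_mul_Lq ν Real.HolderConjugate.two_two hf.aemeasurable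
    hg.aemeasurable
  simp only [Pi.mul_apply, ENNReal.rpow_two] at h
  have h2 : ∀ a : ENNReal, (a ^ (1 / 2 : ℝ)) ^ 2 = a := fun a => by
    rw [← ENNReal.rpow_natCast, ← ENNReal.rpow_mul]; norm_num
  calc _ ≤ _ := pow_le_pow_left' h 2
    _ = _ := by rw [mul_pow, h2, h2]

lemma enorm_integral_mul_conj_self {g : X → ℂ} (hg : Measurable g)
    (hfin : ∫⁻ x, ‖g x‖ₑ ^ 2 ∂μ ≠ ⊤) :
    ‖∫ x, g x * (starRingEnd ℂ) (g x) ∂μ‖ₑ = ∫⁻ x, ‖g x‖ₑ ^ 2 ∂μ := by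
  have h1 : ∀ x, g x * (starRingEnd ℂ) (g x) = ((‖g x‖ ^ 2 : ℝ) : ℂ) := fun x => by
    rw [Complex.mul_conj, Complex.normSq_eq_norm_sq]
  have h2 : ∀ x, ‖g x‖ₑ ^ 2 = ENNReal.ofReal (‖g x‖ ^ 2) := fun x => by
    rw [ENNReal.ofReal_pow (norm_nonneg _), ofReal_norm]
  simp only [h1, h2] at hfin ⊢
  rw [integral_complex_ofReal, ← ofReal_norm, Complex.norm_real, Real.norm_of_nonneg
    (integral_nonneg fun x => sq_nonneg _), integral_eq_lintegral_of_nonneg_ae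
    (Filter.Eventually.of_forall fun x => sq_nonneg _)
    (hg.norm.pow_const 2).aestronglyMeasurable, ENNReal.ofReal_toReal hfin]

variable [SFinite μ] [SFinite ν]

/-- Schur's test for a nonnegative kernel, with a constant that is not optimal. -/
lemma lintegral_mul_mul_le_of_schur {G : X → ENNReal} {H : Y → ENNReal} {W : X → Y → ENNReal}
    {B : ENNReal} (hG : Measurable G) (hH : Measurable H) (hW : Measurable (Function.uncurry W))
    (h₁ : ∀ x, ∫⁻ y, W x y ∂ν ≤ B) (h₂ : ∀ y, ∫⁻ x, W x y ∂μ ≤ B) :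
    ∫⁻ p, G p.1 * H p.2 * W p.1 p.2 ∂(μ.prod ν) ≤
      B * (∫⁻ x, G x ^ 2 ∂μ + ∫⁻ y, H y ^ 2 ∂ν) := by
  have hW' : Measurable fun p : X × Y => W p.1 p.2 := hW
  have hG' : Measurable fun p : X × Y => G p.1 := hG.comp measurable_fst
  have hH' : Measurable fun p : X × Y => H p.2 := hH.comp measurable_snd
  have hm₁ : Measurable fun p : X × Y => G p.1 ^ 2 * W p.1 p.2 := (hG'.pow_const 2).mul hW'
  have hm₂ : Measurable fun p : X × Y => H p.2 ^ 2 * W p.1 p.2 := (hH'.pow_const 2).mul hW'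
  have hWx : ∀ x, Measurable fun y => W x y := fun x => hW.comp measurable_prodMk_left
  have hWy : ∀ y, Measurable fun x => W x y := fun y => hW.comp measurable_prodMk_right
  calc ∫⁻ p, G p.1 * H p.2 * W p.1 p.2 ∂(μ.prod ν)
      ≤ ∫⁻ p, (G p.1 ^ 2 * W p.1 p.2 + H p.2 ^ 2 * W p.1 p.2) ∂(μ.prod ν) := by
        refine lintegral_mono fun p => ?_
        rw [← add_mul]
        gcongr
        exact ENNReal.mul_le_sq_add_sq _ _
    _ = ∫⁻ x, ∫⁻ y, G x ^ 2 * W x y ∂ν ∂μ + ∫⁻ y, ∫⁻ x, H y ^ 2 * W x y ∂μ ∂ν := by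
        rw [lintegral_add_left hm₁, lintegral_prod _ hm₁.aemeasurable,
          lintegral_prod_symm _ hm₂.aemeasurable]
    _ ≤ ∫⁻ x, B * G x ^ 2 ∂μ + ∫⁻ y, B * H y ^ 2 ∂ν := by
        gcongr with x y
        · rw [lintegral_const_mul _ (hWx x), mul_comm]
          gcongr
          exact h₁ x
        · rw [lintegral_const_mul _ (hWy y), mul_comm]
          gcongr
          exact h₂ y
    _ = _ := by
        rw [lintegral_const_mul _ (hG.pow_const 2), lintegral_const_mul _ (hH.pow_const 2), mul_add]

/-- The kernel of `TT*` inherits a Schur bound from the kernel `V` of `T`. -/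
lemma lintegral_lintegral_mul_le {V : X → Y → ENNReal} {C : ENNReal}
    (hV : Measurable (Function.uncurry V))
    (h₁ : ∀ x, ∫⁻ y, V x y ∂ν ≤ C) (h₂ : ∀ y, ∫⁻ x, V x y ∂μ ≤ C) (x : X) :
    ∫⁻ x', ∫⁻ y, V x y * V x' y ∂ν ∂μ ≤ C * C := by
  have hV1 : Measurable fun y => V x y := hV.comp measurable_prodMk_left
  rw [lintegral_lintegral_swap ((hV1.comp measurable_snd).mul
    (hV : Measurable fun p : X × Y => V p.1 p.2)).aemeasurable]
  calc ∫⁻ y, ∫⁻ x', V x y * V x' y ∂μ ∂ν ≤ ∫⁻ y, V x y * C ∂ν := by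
        refine lintegral_mono fun y => ?_
        have hVy : Measurable fun x => V x y := hV.comp measurable_prodMk_right
        rw [lintegral_const_mul _ hVy]
        gcongr
        exact h₂ y
    _ ≤ C * C := by
        rw [lintegral_mul_const _ hV1]
        gcongr
        exact h₁ x

/-- The triple integral to which Fubini's theorem is applied in the expansion of `‖T* g‖²`. -/
lemma lintegral_triple_le {V : X → Y → ENNReal} {C : ENNReal} {G : X → ENNReal}
    (hG : Measurable G) (hV : Measurable (Function.uncurry V))
    (h₁ : ∀ x, ∫⁻ y, V x y ∂ν ≤ C) (h₂ : ∀ y, ∫⁻ x, V x y ∂μ ≤ C) :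
    ∫⁻ q : (X × X) × Y, G q.1.1 * G q.1.2 * (V q.1.1 q.2 * V q.1.2 q.2) ∂((μ.prod μ).prod ν) ≤
      C * C * (∫⁻ x, G x ^ 2 ∂μ + ∫⁻ x, G x ^ 2 ∂μ) := by
  have hVa : Measurable fun q : (X × X) × Y => V q.1.1 q.2 :=
    hV.comp ((measurable_fst.comp measurable_fst).prodMk measurable_snd)
  have hVb : Measurable fun q : (X × X) × Y => V q.1.2 q.2 :=
    hV.comp ((measurable_snd.comp measurable_fst).prodMk measurable_snd)
  have hGa : Measurable fun q : (X × X) × Y => G q.1.1 :=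
    hG.comp (measurable_fst.comp measurable_fst)
  have hGb : Measurable fun q : (X × X) × Y => G q.1.2 :=
    hG.comp (measurable_snd.comp measurable_fst)
  have hVV : Measurable fun q : (X × X) × Y => V q.1.1 q.2 * V q.1.2 q.2 := hVa.mul hVb
  have hm : Measurable fun q : (X × X) × Y =>
      G q.1.1 * G q.1.2 * (V q.1.1 q.2 * V q.1.2 q.2) := (hGa.mul hGb).mul hVV
  rw [lintegral_prod _ hm.aemeasurable]
  have h3 : ∀ p : X × X, ∫⁻ y, G p.1 * G p.2 * (V p.1 y * V p.2 y) ∂ν =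
      G p.1 * G p.2 * ∫⁻ y, V p.1 y * V p.2 y ∂ν := fun p =>
    lintegral_const_mul _ (hVV.comp measurable_prodMk_left)
  simp only [h3]
  refine lintegral_mul_mul_le_of_schur (W := fun x x' => ∫⁻ y, V x y * V x' y ∂ν) hG hG
    hVV.lintegral_prod_right' (fun x => lintegral_lintegral_mul_le hV h₁ h₂ x) (fun x => ?_)
  simp only [mul_comm (V _ _) (V x _)]
  exact lintegral_lintegral_mul_le hV h₁ h₂ x

lemma lintegral_sq_lintegral_mul_le {V : X → Y → ENNReal} {C : ENNReal} {G : X → ENNReal}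
    (hG : Measurable G) (hV : Measurable (Function.uncurry V))
    (h₁ : ∀ x, ∫⁻ y, V x y ∂ν ≤ C) (h₂ : ∀ y, ∫⁻ x, V x y ∂μ ≤ C) :
    ∫⁻ y, (∫⁻ x, V x y * G x ∂μ) ^ 2 ∂ν ≤ C * C * (∫⁻ x, G x ^ 2 ∂μ + ∫⁻ x, G x ^ 2 ∂μ) := by
  refine le_trans (le_of_eq ?_) (lintegral_triple_le hG hV h₁ h₂)
  have hVa : Measurable fun q : (X × X) × Y => V q.1.1 q.2 :=
    hV.comp ((measurable_fst.comp measurable_fst).prodMk measurable_snd)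
  have hVb : Measurable fun q : (X × X) × Y => V q.1.2 q.2 :=
    hV.comp ((measurable_snd.comp measurable_fst).prodMk measurable_snd)
  have hGa : Measurable fun q : (X × X) × Y => G q.1.1 :=
    hG.comp (measurable_fst.comp measurable_fst)
  have hGb : Measurable fun q : (X × X) × Y => G q.1.2 :=
    hG.comp (measurable_snd.comp measurable_fst)
  have hm : Measurable fun q : (X × X) × Y =>
      G q.1.1 * G q.1.2 * (V q.1.1 q.2 * V q.1.2 q.2) := (hGa.mul hGb).mul (hVa.mul hVb)
  rw [lintegral_prod_symm _ hm.aemeasurable]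
  refine lintegral_congr fun y => ?_
  have hm : Measurable fun x => V x y * G x := (hV.comp measurable_prodMk_right).mul hG
  rw [sq, ← lintegral_prod_mul hm.aemeasurable hm.aemeasurable]
  refine lintegral_congr fun p => ?_
  ring

/-- `‖T* g‖² = ⟨TT* g, g⟩` is bounded by means of Schur's test for the kernel of `TT*`. -/
lemma lintegral_sq_adjoint_le {k : X → Y → ℂ} {C B : ENNReal} (hC : C ≠ ⊤)
    (hk : Measurable (Function.uncurry k))
    (h₁ : ∀ x, ∫⁻ y, ‖k x y‖ₑ ∂ν ≤ C) (h₂ : ∀ y, ∫⁻ x, ‖k x y‖ₑ ∂μ ≤ C)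
    (hB : ∀ x, ∫⁻ x', ‖∫ y, k x y * (starRingEnd ℂ) (k x' y) ∂ν‖ₑ ∂μ ≤ B)
    {g : X → ℂ} (hg : Measurable g) (hfin : ∫⁻ x, ‖g x‖ₑ ^ 2 ∂μ ≠ ⊤) :
    ∫⁻ y, ‖∫ x, g x * (starRingEnd ℂ) (k x y) ∂μ‖ₑ ^ 2 ∂ν ≤
      B * (∫⁻ x, ‖g x‖ₑ ^ 2 ∂μ + ∫⁻ x, ‖g x‖ₑ ^ 2 ∂μ) := by
  have hconj : Measurable (starRingEnd ℂ) := Complex.continuous_conj.measurable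
  have hV : Measurable (Function.uncurry fun x y => ‖k x y‖ₑ) := hk.enorm
  have hS : Measurable fun y => ∫ x, g x * (starRingEnd ℂ) (k x y) ∂μ := by
    have : Measurable fun p : Y × X => g p.2 * (starRingEnd ℂ) (k p.2 p.1) :=
      (hg.comp measurable_snd).mul (hconj.comp (hk.comp measurable_swap))
    exact this.stronglyMeasurable.integral_prod_right'.measurable
  have hSfin : ∫⁻ y, ‖∫ x, g x * (starRingEnd ℂ) (k x y) ∂μ‖ₑ ^ 2 ∂ν ≠ ⊤ := by
    refine ne_top_of_le_ne_top ?_ (le_trans (lintegral_mono fun y => ?_)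
      (lintegral_sq_lintegral_mul_le hg.enorm hV h₁ h₂))
    · exact ENNReal.mul_ne_top (ENNReal.mul_ne_top hC hC) (ENNReal.add_ne_top.2 ⟨hfin, hfin⟩)
    · refine pow_le_pow_left' ((enorm_integral_le_lintegral_enorm _).trans (le_of_eq ?_)) 2
      refine lintegral_congr fun x => ?_
      rw [enorm_mul, mul_comm, RCLike.enorm_conj]
  rw [← enorm_integral_mul_conj_self hS hSfin]
  -- the integrand of the triple integral
  set F : (X × X) × Y → ℂ := fun q =>
    g q.1.2 * (starRingEnd ℂ) (g q.1.1) * (k q.1.1 q.2 * (starRingEnd ℂ) (k q.1.2 q.2)) with hF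
  have hka : Measurable fun q : (X × X) × Y => k q.1.1 q.2 :=
    hk.comp ((measurable_fst.comp measurable_fst).prodMk measurable_snd)
  have hkb : Measurable fun q : (X × X) × Y => (starRingEnd ℂ) (k q.1.2 q.2) :=
    hconj.comp (hk.comp ((measurable_snd.comp measurable_fst).prodMk measurable_snd))
  have hFm : Measurable F :=
    ((hg.comp (measurable_snd.comp measurable_fst)).mul
      (hconj.comp (hg.comp (measurable_fst.comp measurable_fst)))).mul (hka.mul hkb)
  have hFint : Integrable F ((μ.prod μ).prod ν) := by
    refine ⟨hFm.aestronglyMeasurable, lt_of_le_of_lt ?_ (lt_top_iff_ne_top.2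
      (ENNReal.mul_ne_top (ENNReal.mul_ne_top hC hC) (ENNReal.add_ne_top.2 ⟨hfin, hfin⟩)))⟩
    refine le_trans (le_of_eq ?_) (lintegral_triple_le hg.enorm hV h₁ h₂)
    refine lintegral_congr fun q => ?_
    simp only [hF, enorm_mul, RCLike.enorm_conj]
    ring
  have hexp : ∫ y, (∫ x, g x * (starRingEnd ℂ) (k x y) ∂μ) *
      (starRingEnd ℂ) (∫ x, g x * (starRingEnd ℂ) (k x y) ∂μ) ∂ν =
      ∫ p : X × X, g p.2 * (starRingEnd ℂ) (g p.1) *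
        ∫ y, k p.1 y * (starRingEnd ℂ) (k p.2 y) ∂ν ∂(μ.prod μ) := by
    calc _ = ∫ y, ∫ p : X × X, F (p, y) ∂(μ.prod μ) ∂ν := by
          refine integral_congr_ae (Filter.Eventually.of_forall fun y => ?_)
          beta_reduce
          rw [← integral_conj, mul_comm, ← integral_prod_mul]
          refine integral_congr_ae (Filter.Eventually.of_forall fun p => ?_)
          simp only [hF, map_mul, Complex.conj_conj]
          ring
      _ = ∫ p : X × X, ∫ y, F (p, y) ∂ν ∂(μ.prod μ) := by
          rw [integral_integral_swap (f := fun y p => F (p, y)) hFint.swap]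
      _ = _ := by
          refine integral_congr_ae (Filter.Eventually.of_forall fun p => ?_)
          simp only [hF]
          rw [integral_const_mul]
  rw [hexp]
  have hK : Measurable fun p : X × X => ∫ y, k p.1 y * (starRingEnd ℂ) (k p.2 y) ∂ν :=
    (hka.mul hkb).stronglyMeasurable.integral_prod_right'.measurable
  refine (enorm_integral_le_lintegral_enorm _).trans ?_
  calc _ = ∫⁻ p : X × X, ‖g p.1‖ₑ * ‖g p.2‖ₑ *
        ‖∫ y, k p.1 y * (starRingEnd ℂ) (k p.2 y) ∂ν‖ₑ ∂(μ.prod μ) := by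
        refine lintegral_congr fun p => ?_
        rw [enorm_mul, enorm_mul, RCLike.enorm_conj, mul_comm ‖g p.2‖ₑ]
    _ ≤ _ := by
        refine lintegral_mul_mul_le_of_schur
          (W := fun x x' => ‖∫ y, k x y * (starRingEnd ℂ) (k x' y) ∂ν‖ₑ) hg.enorm hg.enorm
          hK.enorm hB (fun x => ?_)
        refine le_trans (le_of_eq (lintegral_congr fun x' => ?_)) (hB x)
        rw [← RCLike.enorm_conj (∫ y, k x y * (starRingEnd ℂ) (k x' y) ∂ν), ← integral_conj]
        congr 2
        funext y
        rw [map_mul, Complex.conj_conj, mul_comm]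

lemma lintegral_sq_integral_kernel_le {k : X → Y → ℂ} {C B : ENNReal} (hC : C ≠ ⊤)
    (hk : Measurable (Function.uncurry k))
    (h₁ : ∀ x, ∫⁻ y, ‖k x y‖ₑ ∂ν ≤ C) (h₂ : ∀ y, ∫⁻ x, ‖k x y‖ₑ ∂μ ≤ C)
    (hB : ∀ x, ∫⁻ x', ‖∫ y, k x y * (starRingEnd ℂ) (k x' y) ∂ν‖ₑ ∂μ ≤ B)
    {f : Y → ℂ} (hf : Measurable f) (hfin : ∫⁻ y, ‖f y‖ₑ ^ 2 ∂ν ≠ ⊤) :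
    ∫⁻ x, ‖∫ y, k x y * f y ∂ν‖ₑ ^ 2 ∂μ ≠ ⊤ ∧
    ∫⁻ x, ‖∫ y, k x y * f y ∂ν‖ₑ ^ 2 ∂μ ≤ 2 * B * ∫⁻ y, ‖f y‖ₑ ^ 2 ∂ν := by
  have hconj : Measurable (starRingEnd ℂ) := Complex.continuous_conj.measurable
  set g : X → ℂ := fun x => ∫ y, k x y * f y ∂ν with hgdef
  have hk' : Measurable fun p : X × Y => k p.1 p.2 := hk
  have hg : Measurable g := by
    have : Measurable fun p : X × Y => k p.1 p.2 * f p.2 := hk'.mul (hf.comp measurable_snd)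
    exact this.stronglyMeasurable.integral_prod_right'.measurable
  have hV' : Measurable (Function.uncurry fun y x => ‖k x y‖ₑ) := (hk.comp measurable_swap).enorm
  have hgfin : ∫⁻ x, ‖g x‖ₑ ^ 2 ∂μ ≠ ⊤ := by
    refine ne_top_of_le_ne_top ?_ (le_trans (lintegral_mono fun x => ?_)
      (lintegral_sq_lintegral_mul_le hf.enorm hV' h₂ h₁))
    · exact ENNReal.mul_ne_top (ENNReal.mul_ne_top hC hC) (ENNReal.add_ne_top.2 ⟨hfin, hfin⟩)
    · refine pow_le_pow_left' ((enorm_integral_le_lintegral_enorm _).trans (le_of_eq ?_)) 2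
      simp only [enorm_mul]
  refine ⟨hgfin, ?_⟩
  set h : Y → ℂ := fun y => ∫ x, g x * (starRingEnd ℂ) (k x y) ∂μ with hh
  have hhm : Measurable h := by
    have : Measurable fun p : Y × X => g p.2 * (starRingEnd ℂ) (k p.2 p.1) :=
      (hg.comp measurable_snd).mul (hconj.comp (hk.comp measurable_swap))
    exact this.stronglyMeasurable.integral_prod_right'.measurable
  have hadj : ∫⁻ y, ‖h y‖ₑ ^ 2 ∂ν ≤ B * (∫⁻ x, ‖g x‖ₑ ^ 2 ∂μ + ∫⁻ x, ‖g x‖ₑ ^ 2 ∂μ) :=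
    lintegral_sq_adjoint_le hC hk h₁ h₂ hB hg hgfin
  have hint : Integrable (fun p : X × Y => k p.1 p.2 * f p.2 * (starRingEnd ℂ) (g p.1))
      (μ.prod ν) := by
    refine ⟨((hk'.mul (hf.comp measurable_snd)).mul
      (hconj.comp (hg.comp measurable_fst))).aestronglyMeasurable, lt_of_le_of_lt ?_
      (lt_top_iff_ne_top.2 (ENNReal.mul_ne_top hC (ENNReal.add_ne_top.2 ⟨hgfin, hfin⟩)))⟩
    refine le_trans (le_of_eq (lintegral_congr fun p => ?_))
      (lintegral_mul_mul_le_of_schur (W := fun x y => ‖k x y‖ₑ) hg.enorm hf.enorm hk.enorm h₁ h₂)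
    simp only [enorm_mul, RCLike.enorm_conj]
    ring
  -- `‖g‖² = ⟨f, T* g⟩`
  have hdual : ∫ x, g x * (starRingEnd ℂ) (g x) ∂μ = ∫ y, f y * (starRingEnd ℂ) (h y) ∂ν := by
    calc _ = ∫ x, ∫ y, k x y * f y * (starRingEnd ℂ) (g x) ∂ν ∂μ := by
          refine integral_congr_ae (Filter.Eventually.of_forall fun x => ?_)
          beta_reduce
          rw [integral_mul_const]
      _ = ∫ y, ∫ x, k x y * f y * (starRingEnd ℂ) (g x) ∂μ ∂ν := integral_integral_swap hint
      _ = _ := by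
          refine integral_congr_ae (Filter.Eventually.of_forall fun y => ?_)
          beta_reduce
          rw [hh]
          beta_reduce
          rw [← integral_conj, ← integral_const_mul]
          refine integral_congr_ae (Filter.Eventually.of_forall fun x => ?_)
          simp only [map_mul, Complex.conj_conj]
          ring
  set Z := ∫⁻ x, ‖g x‖ₑ ^ 2 ∂μ with hZ
  have h1 : Z ≤ ∫⁻ y, ‖f y‖ₑ * ‖h y‖ₑ ∂ν := by
    rw [hZ, ← enorm_integral_mul_conj_self hg hgfin, hdual]
    refine (enorm_integral_le_lintegral_enorm _).trans (le_of_eq (lintegral_congr fun y => ?_))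
    rw [enorm_mul, RCLike.enorm_conj]
  have h2 : Z * Z ≤ (2 * B * ∫⁻ y, ‖f y‖ₑ ^ 2 ∂ν) * Z := by
    calc Z * Z = Z ^ 2 := (sq Z).symm
      _ ≤ _ := pow_le_pow_left' h1 2
      _ ≤ _ := sq_lintegral_mul_le hf.enorm hhm.enorm
      _ ≤ (∫⁻ y, ‖f y‖ₑ ^ 2 ∂ν) * (B * (Z + Z)) := by gcongr
      _ = _ := by ring
  by_cases hZ0 : Z = 0
  · rw [hZ0]; exact zero_le
  · exact (ENNReal.mul_le_mul_iff_left hZ0 hgfin).1 h2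

lemma eLpNorm_two_sq {Ω : Type*} [MeasurableSpace Ω] (f : Ω → ℂ) (m : Measure Ω) :
    eLpNorm f 2 m ^ 2 = ∫⁻ x, ‖f x‖ₑ ^ 2 ∂m := by
  have h := eLpNorm_nnreal_pow_eq_lintegral (f := f) (μ := m) (p := 2) (by norm_num)
  simpa using h

/-- If the kernel of `TT*` has integral at most `B` in one variable, then `T` has norm at most
`√(2 B)` on `L²`. The qualitative bounds on the kernel of `T` itself serve to apply Fubini's
theorem. -/
lemma memLp_integral_kernel {k : X → Y → ℂ} {C B : ENNReal} (hC : C ≠ ⊤)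
    (hk : Measurable (Function.uncurry k))
    (h₁ : ∀ x, ∫⁻ y, ‖k x y‖ₑ ∂ν ≤ C) (h₂ : ∀ y, ∫⁻ x, ‖k x y‖ₑ ∂μ ≤ C)
    (hB : ∀ x, ∫⁻ x', ‖∫ y, k x y * (starRingEnd ℂ) (k x' y) ∂ν‖ₑ ∂μ ≤ B)
    {f : Y → ℂ} (hf : MemLp f 2 ν) :
    MemLp (fun x => ∫ y, k x y * f y ∂ν) 2 μ ∧
      eLpNorm (fun x => ∫ y, k x y * f y ∂ν) 2 μ ^ 2 ≤ 2 * B * eLpNorm f 2 ν ^ 2 := by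
  obtain ⟨f', hf'm, hff'⟩ := hf.1.aemeasurable
  have heq : ∀ x, ∫ y, k x y * f y ∂ν = ∫ y, k x y * f' y ∂ν := fun x =>
    integral_congr_ae (hff'.mono fun y hy => by simp only [hy])
  simp only [heq]
  rw [eLpNorm_congr_ae hff', eLpNorm_two_sq, eLpNorm_two_sq]
  have hfin : ∫⁻ y, ‖f' y‖ₑ ^ 2 ∂ν ≠ ⊤ := by
    rw [← eLpNorm_two_sq, ← eLpNorm_congr_ae hff']
    exact ENNReal.pow_ne_top hf.2.ne
  obtain ⟨h3, h4⟩ := lintegral_sq_integral_kernel_le hC hk h₁ h₂ hB hf'm hfin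
  refine ⟨⟨?_, ?_⟩, h4⟩
  · have : Measurable fun p : X × Y => k p.1 p.2 * f' p.2 :=
      (hk : Measurable fun p : X × Y => k p.1 p.2).mul (hf'm.comp measurable_snd)
    exact this.stronglyMeasurable.integral_prod_right'.aestronglyMeasurable
  · rw [← eLpNorm_two_sq] at h3
    rw [lt_top_iff_ne_top]
    intro h
    rw [h] at h3
    exact h3 (by simp)

end KernelBound

/-! ### The kernel of the Carleson piece -/

lemma lintegral_comp_const_mul (H : ℝ → ENNReal) {c : ℝ} (hc : c ≠ 0) :
    ∫⁻ u, H (c * u) = ENNReal.ofReal |c⁻¹| * ∫⁻ u, H u := by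
  have h := lintegral_map_equiv (μ := volume) H (Homeomorph.mulLeft₀ c hc).toMeasurableEquiv
  have hmap : Measure.map (Homeomorph.mulLeft₀ c hc).toMeasurableEquiv volume =
      ENNReal.ofReal |c⁻¹| • (volume : Measure ℝ) := Real.map_volume_mul_left hc
  rw [hmap, lintegral_smul_measure] at h
  exact h.symm

lemma integral_eq_integral_comp_sub_mul (g : ℝ → ℂ) (x : ℝ) {c : ℝ} (hc : c ≠ 0) :
    ∫ z, g z = |c| * ∫ t, g (x - c * t) := by
  have h := Measure.integral_comp_mul_left (fun u => g (x - u)) c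
  rw [integral_sub_left_eq_self g volume x] at h
  rw [h, Complex.real_smul, ← mul_assoc, ← Complex.ofReal_mul, abs_inv,
    mul_inv_cancel₀ (abs_ne_zero.2 hc)]
  simp

lemma measurable_branchPow (s α : ℝ) : Measurable (branchPow s α) := by
  unfold branchPow
  refine Measurable.ite measurableSet_Ici ?_ ?_
  · fun_prop
  · fun_prop

lemma measurable_hybridCurve {d : ℕ} (α s : Fin d → ℝ) {a₀ : ℝ → ℝ} {a : Fin d → ℝ → ℝ}
    (h₀ : Measurable a₀) (h : ∀ k, Measurable (a k)) :
    Measurable fun p : ℝ × ℝ => hybridCurve α s a₀ a p.1 p.2 := by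
  unfold hybridCurve
  refine ((h₀.comp measurable_fst).mul measurable_snd).add (Finset.measurable_sum _ fun k _ => ?_)
  exact ((h k).comp measurable_fst).mul ((measurable_branchPow _ _).comp measurable_snd)

lemma measurable_nonlinearSize {d : ℕ} (α : Fin d → ℝ) {a : Fin d → ℝ → ℝ} (j : ℤ)
    (h : ∀ k, Measurable (a k)) : Measurable (nonlinearSize α a j) := by
  unfold nonlinearSize
  exact Finset.measurable_sum _ fun k _ => (h k).abs.mul_const _

lemma abs_mem_of_ne_zero_of_tsupport_subset {ρ : ℝ → ℝ}
    (h : tsupport ρ ⊆ {t : ℝ | 1 / 4 < |t| ∧ |t| < 4}) {t : ℝ} (ht : ρ t ≠ 0) :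
    1 / 4 < |t| ∧ |t| < 4 :=
  h (subset_tsupport ρ ht)

lemma exists_abs_le_of_tsupport_subset {ρ : ℝ → ℝ} (hρ : Continuous ρ)
    (h : tsupport ρ ⊆ {t : ℝ | 1 / 4 < |t| ∧ |t| < 4}) : ∃ C : ℝ, 0 < C ∧ ∀ t, |ρ t| ≤ C := by
  have hcs : HasCompactSupport ρ := HasCompactSupport.intro (isCompact_closedBall (0 : ℝ) 4)
    fun t ht => by
      by_contra hne
      refine ht ?_
      rw [mem_closedBall_zero_iff, Real.norm_eq_abs]
      exact (abs_mem_of_ne_zero_of_tsupport_subset h hne).2.le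
  obtain ⟨C, hC⟩ := hcs.exists_bound_of_continuous hρ
  refine ⟨|C| + 1, by positivity, fun t => ?_⟩
  have := hC t
  rw [Real.norm_eq_abs] at this
  linarith [le_abs_self C]

lemma IsDyadicKernel.continuous_dilate {ρ : ℝ → ℝ} (hρ : IsDyadicKernel ρ) (j : ℤ) :
    Continuous (dyadicDilate ρ j) := by
  unfold dyadicDilate
  exact continuous_const.mul (hρ.smooth.continuous.comp (continuous_const.mul continuous_id))

lemma IsDyadicKernel.hasCompactSupport_dilate {ρ : ℝ → ℝ} (hρ : IsDyadicKernel ρ) (j : ℤ) :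
    HasCompactSupport (dyadicDilate ρ j) := by
  refine HasCompactSupport.intro (isCompact_closedBall (0 : ℝ) (4 * (2 : ℝ) ^ (-j))) fun t ht => ?_
  by_contra hne
  refine ht ?_
  have h := (abs_mem_of_ne_zero_of_tsupport_subset hρ.supp (right_ne_zero_of_mul hne)).2
  have h2 : (0 : ℝ) < 2 ^ j := by positivity
  rw [abs_mul, abs_of_pos h2] at h
  rw [mem_closedBall_zero_iff, Real.norm_eq_abs, zpow_neg, ← div_eq_mul_inv, le_div_iff₀ h2]
  linarith

/-- The coefficients of the curve, rescaled to unit scale and divided by `2 ^ m`, on the half-line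
of the sign of `σ`. -/
noncomputable def rescaledCoeff {d : ℕ} (α s : Fin d → ℝ) (a : Fin d → ℝ → ℝ) (j : ℤ) (m : ℕ)
    (σ x : ℝ) (k : Fin d) : ℝ :=
  a k x * (if 0 < σ then 1 else s k) * (2 : ℝ) ^ (-(j : ℝ) * α k) / 2 ^ m

lemma sum_abs_rescaledCoeff {d : ℕ} (α s : Fin d → ℝ) (hs : ∀ k, s k = 1 ∨ s k = -1)
    (a : Fin d → ℝ → ℝ) (j : ℤ) (m : ℕ) (σ x : ℝ) :
    ∑ k, |rescaledCoeff α s a j m σ x k| = nonlinearSize α a j x / 2 ^ m := by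
  unfold rescaledCoeff nonlinearSize
  rw [Finset.sum_div]
  refine Finset.sum_congr rfl fun k _ => ?_
  have h1 : |(if 0 < σ then 1 else s k)| = 1 := by
    split_ifs
    · simp
    · rcases hs k with h | h <;> simp [h]
  have h2 : (0 : ℝ) < 2 ^ (-(j : ℝ) * α k) := by positivity
  rw [abs_div, abs_mul, abs_mul, h1, mul_one, abs_of_pos h2,
    abs_of_pos (show (0 : ℝ) < 2 ^ m by positivity)]

lemma hybridCurve_rescale {d : ℕ} (α s : Fin d → ℝ) (a₀ : ℝ → ℝ) (a : Fin d → ℝ → ℝ)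
    (j : ℤ) (m : ℕ) {σ : ℝ} (hσ : σ = 1 ∨ σ = -1) (x : ℝ) {t : ℝ} (ht : 0 < t) :
    hybridCurve α s a₀ a x (σ * (2 : ℝ) ^ (-j) * t) =
      a₀ x * (σ * (2 : ℝ) ^ (-j)) * t + 2 ^ m * genPoly α (rescaledCoeff α s a j m σ x) 0 t := by
  have h2 : (0 : ℝ) < 2 ^ (-j) := by positivity
  have hpow : ∀ p : ℝ, ((2 : ℝ) ^ (-j) * t) ^ p = (2 : ℝ) ^ (-(j : ℝ) * p) * t ^ p := fun p => by
    rw [Real.mul_rpow h2.le ht.le, ← Real.rpow_intCast, ← Real.rpow_mul (by norm_num)]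
    push_cast
    rfl
  have hbr : ∀ k, branchPow (s k) (α k) (σ * (2 : ℝ) ^ (-j) * t) =
      (if 0 < σ then 1 else s k) * ((2 : ℝ) ^ (-(j : ℝ) * α k) * t ^ α k) := by
    intro k
    rw [← hpow]
    have hpos : 0 < (2 : ℝ) ^ (-j) * t := by positivity
    unfold branchPow
    rcases hσ with h | h
    · subst h
      rw [one_mul, if_pos hpos.le, if_pos one_pos, abs_of_pos hpos, one_mul]
    · subst h
      have h3 : (-1 : ℝ) * 2 ^ (-j) * t = -(2 ^ (-j) * t) := by ring
      rw [h3, if_neg (by linarith), if_neg (by norm_num), abs_neg, abs_of_pos hpos]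
  unfold hybridCurve genPoly rescaledCoeff
  rw [Finset.mul_sum]
  congr 1
  · ring
  · refine Finset.sum_congr rfl fun k _ => ?_
    rw [hbr]
    simp only [descPochhammer_zero, Polynomial.eval_one, one_mul, Nat.cast_zero, sub_zero]
    field_simp

/-- The part of the kernel of the Carleson piece, as an operator `f ↦ ∫ k x z * f z dz`, that lives
where `x - z` has the sign of `σ`. -/
noncomputable def pieceKernel (ρ φ : ℝ → ℝ) {d : ℕ} (α s : Fin d → ℝ) (a₀ : ℝ → ℝ)
    (a : Fin d → ℝ → ℝ) (j : ℤ) (m : ℕ) (σ x z : ℝ) : ℂ :=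
  if 0 < σ * (x - z) then
    Complex.exp (Complex.I * (hybridCurve α s a₀ a x (x - z) : ℂ)) *
      (dyadicDilate ρ j (x - z) : ℂ) * (φ (nonlinearSize α a j x / 2 ^ m) : ℂ)
  else 0

lemma norm_exp_I_mul_ofReal (x : ℝ) : ‖Complex.exp (Complex.I * (x : ℂ))‖ = 1 := by
  rw [mul_comm]; exact Complex.norm_exp_ofReal_mul_I _

section Piece

variable {ρ φ : ℝ → ℝ} {d : ℕ} {α s : Fin d → ℝ} {a₀ : ℝ → ℝ} {a : Fin d → ℝ → ℝ}

lemma measurable_pieceKernel (hρ : IsDyadicKernel ρ) (hφ : IsDyadicCutoff φ)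
    (h₀ : Measurable a₀) (h : ∀ k, Measurable (a k)) (j : ℤ) (m : ℕ) (σ : ℝ) :
    Measurable (Function.uncurry (pieceKernel ρ φ α s a₀ a j m σ)) := by
  have hsub : Measurable fun p : ℝ × ℝ => p.1 - p.2 := measurable_fst.sub measurable_snd
  have hset : MeasurableSet {p : ℝ × ℝ | 0 < σ * (p.1 - p.2)} :=
    measurableSet_lt measurable_const (hsub.const_mul σ)
  refine Measurable.ite hset ?_ measurable_const
  have h1 : Measurable fun p : ℝ × ℝ => hybridCurve α s a₀ a p.1 (p.1 - p.2) :=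
    (measurable_hybridCurve α s h₀ h).comp (measurable_fst.prodMk hsub)
  have h2 : Measurable fun p : ℝ × ℝ => dyadicDilate ρ j (p.1 - p.2) :=
    (hρ.continuous_dilate j).measurable.comp hsub
  have h3 : Measurable fun p : ℝ × ℝ => φ (nonlinearSize α a j p.1 / 2 ^ m) :=
    hφ.smooth.continuous.measurable.comp
      (((measurable_nonlinearSize α j h).div_const _).comp measurable_fst)
  exact ((Complex.measurable_exp.comp ((Complex.measurable_ofReal.comp h1).const_mul _)).mul
    (Complex.measurable_ofReal.comp h2)).mul (Complex.measurable_ofReal.comp h3)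

lemma enorm_pieceKernel_le {C : ℝ} (hC : ∀ t, |φ t| ≤ C) (j : ℤ) (m : ℕ) (σ x z : ℝ) :
    ‖pieceKernel ρ φ α s a₀ a j m σ x z‖ₑ ≤
      ENNReal.ofReal C * ‖dyadicDilate ρ j (x - z)‖ₑ := by
  have hC0 : 0 ≤ C := (abs_nonneg _).trans (hC 0)
  rw [← ofReal_norm, ← ofReal_norm, ← ENNReal.ofReal_mul hC0]
  refine ENNReal.ofReal_le_ofReal ?_
  unfold pieceKernel
  split_ifs
  · rw [norm_mul, norm_mul, norm_exp_I_mul_ofReal, one_mul, Complex.norm_real, Complex.norm_real,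
      mul_comm]
    gcongr
    exact hC _
  · rw [norm_zero]; positivity

/-- After the substitution `z = x - σ 2 ^ (-j) t` the kernel of `TT*` is an oscillatory integral at
unit scale. -/
lemma integral_pieceKernel_mul_conj (hρ : IsDyadicKernel ρ) (j : ℤ) (m : ℕ) {σ : ℝ}
    (hσ : σ = 1 ∨ σ = -1) (x y : ℝ) :
    ∫ z, pieceKernel ρ φ α s a₀ a j m σ x z *
        (starRingEnd ℂ) (pieceKernel ρ φ α s a₀ a j m σ y z) =
      (((2 : ℝ) ^ j * (φ (nonlinearSize α a j x / 2 ^ m) * φ (nonlinearSize α a j y / 2 ^ m)) : ℝ) :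
        ℂ) * ∫ t in overlap ((σ * (2 : ℝ) ^ (-j))⁻¹ * (x - y)),
          Complex.exp (Complex.I * ((a₀ x * (σ * (2 : ℝ) ^ (-j)) * t +
            2 ^ m * genPoly α (rescaledCoeff α s a j m σ x) 0 t -
            (a₀ y * (σ * (2 : ℝ) ^ (-j)) * (t - (σ * (2 : ℝ) ^ (-j))⁻¹ * (x - y)) +
            2 ^ m * genPoly α (rescaledCoeff α s a j m σ y) 0
              (t - (σ * (2 : ℝ) ^ (-j))⁻¹ * (x - y))) : ℝ) : ℂ)) *
          ((ρ (σ * t) * ρ (σ * (t - (σ * (2 : ℝ) ^ (-j))⁻¹ * (x - y))) : ℝ) : ℂ) := by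
  have h2 : (0 : ℝ) < 2 ^ (-j) := by positivity
  have hσσ : σ * σ = 1 := by rcases hσ with h | h <;> rw [h] <;> norm_num
  have habsσ : |σ| = 1 := by rcases hσ with h | h <;> rw [h] <;> norm_num
  have hσ0 : σ ≠ 0 := fun h => by rw [h] at hσσ; norm_num at hσσ
  set c : ℝ := σ * (2 : ℝ) ^ (-j) with hc
  have hc0 : c ≠ 0 := mul_ne_zero hσ0 h2.ne'
  set r : ℝ := c⁻¹ * (x - y) with hr
  have hker : ∀ x' t : ℝ, 0 < t → pieceKernel ρ φ α s a₀ a j m σ x' (x' - c * t) =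
      Complex.exp (Complex.I * ((a₀ x' * c * t +
        2 ^ m * genPoly α (rescaledCoeff α s a j m σ x') 0 t : ℝ) : ℂ)) *
        (((2 : ℝ) ^ j * ρ (σ * t) : ℝ) : ℂ) * (φ (nonlinearSize α a j x' / 2 ^ m) : ℂ) := by
    intro x' t ht
    have h3 : σ * (c * t) = 2 ^ (-j) * t := by
      calc σ * (c * t) = (σ * σ) * (2 ^ (-j) * t) := by rw [hc]; ring
        _ = _ := by rw [hσσ, one_mul]
    have h4 : (2 : ℝ) ^ j * (c * t) = σ * t := by
      rw [hc, zpow_neg]; field_simp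
    unfold pieceKernel
    rw [sub_sub_cancel, h3, if_pos (by positivity), hc, hybridCurve_rescale α s a₀ a j m hσ x' ht,
      ← hc]
    unfold dyadicDilate
    rw [h4]
  have hker0 : ∀ x' t : ℝ, t ≤ 0 → pieceKernel ρ φ α s a₀ a j m σ x' (x' - c * t) = 0 := by
    intro x' t ht
    have h3 : σ * (c * t) = 2 ^ (-j) * t := by
      calc σ * (c * t) = (σ * σ) * (2 ^ (-j) * t) := by rw [hc]; ring
        _ = _ := by rw [hσσ, one_mul]
    unfold pieceKernel
    rw [sub_sub_cancel, h3, if_neg]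
    exact not_lt.2 (mul_nonpos_of_nonneg_of_nonpos h2.le ht)
  have hy : ∀ t, x - c * t = y - c * (t - r) := fun t => by
    rw [hr]; field_simp; ring
  have hnz : ∀ t, 0 < t → ρ (σ * t) ≠ 0 → 1 / 4 < t ∧ t < 4 := fun t ht h => by
    have := abs_mem_of_ne_zero_of_tsupport_subset hρ.supp h
    rwa [abs_mul, habsσ, one_mul, abs_of_pos ht] at this
  rw [integral_eq_integral_comp_sub_mul _ x hc0, ← integral_const_mul, ← integral_const_mul,
    ← integral_indicator (by exact measurableSet_Ioc)]
  refine integral_congr_ae (Filter.Eventually.of_forall fun t => ?_)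
  beta_reduce
  by_cases ht : t ∈ overlap r
  · rw [Set.indicator_of_mem ht]
    have ht1 : 0 < t := by
      have := lt_of_le_of_lt (le_max_left _ _) ht.1
      linarith
    have ht2 : 0 < t - r := by
      have := lt_of_le_of_lt (le_max_right _ _) ht.1
      linarith
    rw [hker x t ht1, hy t, hker y (t - r) ht2]
    have hcabs : |c| = ((2 : ℝ) ^ j)⁻¹ := by
      rw [hc, abs_mul, habsσ, one_mul, abs_of_pos h2, zpow_neg]
    have h2j : ((2 : ℝ) ^ j) ≠ 0 := by positivity
    simp only [map_mul, ← Complex.exp_conj, Complex.conj_I, Complex.conj_ofReal]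
    have hexp : ∀ A B : ℝ, Complex.exp (Complex.I * ((A - B : ℝ) : ℂ)) =
        Complex.exp (Complex.I * (A : ℂ)) * Complex.exp (-Complex.I * (B : ℂ)) := fun A B => by
      rw [← Complex.exp_add]; congr 1; push_cast; ring
    rw [hexp, hcabs]
    have hreal : ((2 : ℝ) ^ j)⁻¹ * ((2 : ℝ) ^ j * ρ (σ * t)) * ((2 : ℝ) ^ j * ρ (σ * (t - r))) =
        (2 : ℝ) ^ j * (ρ (σ * t) * ρ (σ * (t - r))) := by field_simp
    have hcplx : ((((2 : ℝ) ^ j)⁻¹ : ℝ) : ℂ) * (((2 : ℝ) ^ j * ρ (σ * t) : ℝ) : ℂ) *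
        (((2 : ℝ) ^ j * ρ (σ * (t - r)) : ℝ) : ℂ) =
        (((2 : ℝ) ^ j : ℝ) : ℂ) * ((ρ (σ * t) * ρ (σ * (t - r)) : ℝ) : ℂ) := by
      rw [← Complex.ofReal_mul, ← Complex.ofReal_mul, hreal, Complex.ofReal_mul]
    rw [Complex.ofReal_mul ((2 : ℝ) ^ j) (φ _ * φ _), Complex.ofReal_mul (φ _) (φ _)]
    linear_combination (Complex.exp (Complex.I * ((a₀ x * c * t +
        2 ^ m * genPoly α (rescaledCoeff α s a j m σ x) 0 t : ℝ) : ℂ)) *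
        Complex.exp (-Complex.I * ((a₀ y * c * (t - r) +
        2 ^ m * genPoly α (rescaledCoeff α s a j m σ y) 0 (t - r) : ℝ) : ℂ)) *
        (φ (nonlinearSize α a j x / 2 ^ m) : ℂ) * (φ (nonlinearSize α a j y / 2 ^ m) : ℂ)) * hcplx
  · rw [Set.indicator_of_notMem ht, mul_eq_zero]
    right
    rcases le_or_gt t 0 with h | ht1
    · rw [hker0 x t h, zero_mul]
    rcases le_or_gt (t - r) 0 with h | ht2
    · rw [hy t, hker0 y (t - r) h, map_zero, mul_zero]
    have : ρ (σ * t) = 0 ∨ ρ (σ * (t - r)) = 0 := by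
      by_contra! hcon
      have h3 := hnz t ht1 hcon.1
      have h4 := hnz _ ht2 hcon.2
      exact ht ⟨max_lt h3.1 (by linarith), le_min h3.2.le (by linarith)⟩
    rcases this with h | h
    · rw [hker x t ht1, h]; simp
    · rw [hy t, hker y (t - r) ht2, h]; simp

/-! ### The norm of the Carleson piece -/

/-- The majorant for the rescaled oscillatory integrals, transported to the kernel of `TT*`. The
cutoff `φ` restricts both `x` and `y` to the points where the size of the curve is comparable to
`2 ^ m`. -/
lemma lintegral_enorm_integral_pieceKernel_le (hρ : IsDyadicKernel ρ) (hφ : IsDyadicCutoff φ)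
    (hs : ∀ k, s k = 1 ∨ s k = -1) {σ : ℝ} (hσ : σ = 1 ∨ σ = -1) {C : ℝ}
    (hC : ∀ t, |φ t| ≤ C) {B : ENNReal} (j : ℤ) (m : ℕ)
    (hB : ∀ (c₀ : ℝ) (c : Fin d → ℝ), 1 / 4 ≤ ∑ k, |c k| → ∑ k, |c k| ≤ 4 →
      ∃ H : ℝ → ENNReal, ∫⁻ r, H r ≤ B ∧
        ∀ (r b₀ : ℝ) (b : Fin d → ℝ), ∑ k, |b k| ≤ 4 →
          ‖∫ t in overlap r, Complex.exp (Complex.I * ((c₀ * t + 2 ^ m * genPoly α c 0 t -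
            (b₀ * (t - r) + 2 ^ m * genPoly α b 0 (t - r)) : ℝ) : ℂ)) *
              ((ρ (σ * t) * ρ (σ * (t - r)) : ℝ) : ℂ)‖ₑ ≤ H r) (x : ℝ) :
    ∫⁻ y, ‖∫ z, pieceKernel ρ φ α s a₀ a j m σ x z *
        (starRingEnd ℂ) (pieceKernel ρ φ α s a₀ a j m σ y z)‖ₑ ≤ ENNReal.ofReal (C * C) * B := by
  have hC0 : 0 ≤ C := (abs_nonneg _).trans (hC 0)
  have hsize : ∀ x, φ (nonlinearSize α a j x / 2 ^ m) ≠ 0 →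
      1 / 4 ≤ ∑ k, |rescaledCoeff α s a j m σ x k| ∧
        ∑ k, |rescaledCoeff α s a j m σ x k| ≤ 4 := by
    intro x hx
    have h := abs_mem_of_ne_zero_of_tsupport_subset hφ.supp hx
    rw [← sum_abs_rescaledCoeff α s hs a j m σ x,
      abs_of_nonneg (Finset.sum_nonneg fun k _ => abs_nonneg _)] at h
    exact ⟨h.1.le, h.2.le⟩
  simp only [integral_pieceKernel_mul_conj hρ j m hσ]
  by_cases hx : φ (nonlinearSize α a j x / 2 ^ m) = 0
  · simp [hx]
  obtain ⟨H, hH, hHle⟩ := hB (a₀ x * (σ * (2 : ℝ) ^ (-j))) (rescaledCoeff α s a j m σ x)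
    (hsize x hx).1 (hsize x hx).2
  have h2 : (0 : ℝ) < 2 ^ (-j) := by positivity
  have habsσ : |σ| = 1 := by rcases hσ with h | h <;> rw [h] <;> norm_num
  have hσ0 : σ ≠ 0 := fun h => by rw [h] at habsσ; norm_num at habsσ
  set c : ℝ := σ * (2 : ℝ) ^ (-j) with hc
  have hc0 : c ≠ 0 := mul_ne_zero hσ0 h2.ne'
  have hcabs : |c| = ((2 : ℝ) ^ j)⁻¹ := by
    rw [hc, abs_mul, habsσ, one_mul, abs_of_pos h2, zpow_neg]
  have h2j : (0 : ℝ) < (2 : ℝ) ^ j := by positivity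
  calc _ ≤ ∫⁻ y, ENNReal.ofReal ((2 : ℝ) ^ j * (C * C)) * H (c⁻¹ * (x - y)) := by
        refine lintegral_mono fun y => ?_
        by_cases hy : φ (nonlinearSize α a j y / 2 ^ m) = 0
        · simp [hy]
        rw [enorm_mul]
        refine mul_le_mul' ?_ (hHle _ _ _ (hsize y hy).2)
        rw [← ofReal_norm, Complex.norm_real, Real.norm_eq_abs, abs_mul, abs_mul, abs_of_pos h2j]
        refine ENNReal.ofReal_le_ofReal ?_
        gcongr
        · exact hC _
        · exact hC _
    _ = ENNReal.ofReal ((2 : ℝ) ^ j * (C * C)) * (ENNReal.ofReal |c| * ∫⁻ r, H r) := by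
        rw [lintegral_const_mul' _ _ ENNReal.ofReal_ne_top,
          lintegral_sub_left_eq_self (fun u => H (c⁻¹ * u)) x,
          lintegral_comp_const_mul H (inv_ne_zero hc0), inv_inv]
    _ = ENNReal.ofReal (C * C) * ∫⁻ r, H r := by
        rw [← mul_assoc, ← ENNReal.ofReal_mul (by positivity), hcabs]
        congr 2
        field_simp
    _ ≤ _ := by gcongr

lemma exists_schur_bound_pieceKernel (hρ : IsDyadicKernel ρ) {C : ℝ} (hC : ∀ t, |φ t| ≤ C)
    (j : ℤ) (m : ℕ) (σ : ℝ) :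
    ∃ D : ENNReal, D ≠ ⊤ ∧ (∀ x, ∫⁻ z, ‖pieceKernel ρ φ α s a₀ a j m σ x z‖ₑ ≤ D) ∧
      ∀ z, ∫⁻ x, ‖pieceKernel ρ φ α s a₀ a j m σ x z‖ₑ ≤ D := by
  have hint : Integrable (dyadicDilate ρ j) :=
    (hρ.continuous_dilate j).integrable_of_hasCompactSupport (hρ.hasCompactSupport_dilate j)
  refine ⟨ENNReal.ofReal C * ∫⁻ u, ‖dyadicDilate ρ j u‖ₑ,
    ENNReal.mul_ne_top ENNReal.ofReal_ne_top hint.2.ne, fun x => ?_, fun z => ?_⟩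
  · refine (lintegral_mono fun z => enorm_pieceKernel_le hC j m σ x z).trans (le_of_eq ?_)
    rw [lintegral_const_mul' _ _ ENNReal.ofReal_ne_top,
      lintegral_sub_left_eq_self (fun u => ‖dyadicDilate ρ j u‖ₑ) x]
  · refine (lintegral_mono fun x => enorm_pieceKernel_le hC j m σ x z).trans (le_of_eq ?_)
    rw [lintegral_const_mul' _ _ ENNReal.ofReal_ne_top,
      lintegral_sub_right_eq_self (fun u => ‖dyadicDilate ρ j u‖ₑ) z]

lemma integrable_carlesonIntegrand (hρ : IsDyadicKernel ρ) (h₀ : Measurable a₀)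
    (h : ∀ k, Measurable (a k)) (j : ℤ) {f : ℝ → ℂ} (hf : MemLp f 2 volume) (x : ℝ) :
    Integrable (carlesonIntegrand ρ (hybridCurve α s a₀ a) j f x) volume := by
  have h1 : MemLp (fun t => f (x - t)) 2 volume :=
    hf.comp_measurePreserving (Measure.measurePreserving_sub_left volume x)
  have h2 : MemLp (dyadicDilate ρ j) 2 volume :=
    (hρ.continuous_dilate j).memLp_of_hasCompactSupport (hρ.hasCompactSupport_dilate j)
  have hγ : Measurable fun t => hybridCurve α s a₀ a x t :=
    (measurable_hybridCurve α s h₀ h).comp measurable_prodMk_left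
  have h3 : MemLp (fun t => Complex.exp (Complex.I * (hybridCurve α s a₀ a x t : ℂ)) *
      (dyadicDilate ρ j t : ℂ)) 2 volume := by
    refine h2.of_le ?_ (Filter.Eventually.of_forall fun t => ?_)
    · exact ((Complex.measurable_exp.comp ((Complex.measurable_ofReal.comp hγ).const_mul _)).mul
        (Complex.measurable_ofReal.comp
          (hρ.continuous_dilate j).measurable)).aestronglyMeasurable
    · rw [norm_mul, norm_exp_I_mul_ofReal, one_mul, Complex.norm_real]
  refine (h1.integrable_mul h3).congr (Filter.Eventually.of_forall fun t => ?_)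
  simp only [carlesonIntegrand, Pi.mul_apply]
  ring

/-- No mass is lost on the diagonal, since `ρ` vanishes near `0`. -/
lemma carlesonPiece_eq_add (hρ : IsDyadicKernel ρ) (h₀ : Measurable a₀)
    (h : ∀ k, Measurable (a k)) (j : ℤ) (m : ℕ) {f : ℝ → ℂ} (hf : MemLp f 2 volume) :
    carlesonPiece ρ φ α s a₀ a j m f =
      (fun x => ∫ z, pieceKernel ρ φ α s a₀ a j m 1 x z * f z) +
        fun x => ∫ z, pieceKernel ρ φ α s a₀ a j m (-1) x z * f z := by
  funext x
  have hI := integrable_carlesonIntegrand (α := α) (s := s) hρ h₀ h j hf x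
  set q : ℂ := (φ (nonlinearSize α a j x / 2 ^ m) : ℂ) with hq
  set F : ℝ → ℂ := fun t => carlesonIntegrand ρ (hybridCurve α s a₀ a) j f x t * q with hF
  have hFint : Integrable F := hI.mul_const q
  have hind : ∀ σ : ℝ, (fun z => pieceKernel ρ φ α s a₀ a j m σ x z * f z) =
      fun z => ({t : ℝ | 0 < σ * t}.indicator F) (x - z) := by
    intro σ
    funext z
    unfold pieceKernel
    by_cases hz : 0 < σ * (x - z)
    · rw [if_pos hz, Set.indicator_of_mem (show x - z ∈ {t : ℝ | 0 < σ * t} from hz)]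
      simp only [hF, carlesonIntegrand, sub_sub_cancel, hq]
      ring
    · rw [if_neg hz, Set.indicator_of_notMem (show x - z ∉ {t : ℝ | 0 < σ * t} from hz), zero_mul]
  have hms : ∀ σ : ℝ, MeasurableSet {t : ℝ | 0 < σ * t} := fun σ =>
    measurableSet_lt measurable_const (measurable_const_mul σ)
  have hρ0 : ρ 0 = 0 := by
    by_contra hne
    have := (abs_mem_of_ne_zero_of_tsupport_subset hρ.supp hne).1
    rw [abs_zero] at this
    norm_num at this
  rw [Pi.add_apply, hind, hind,
    integral_sub_left_eq_self ({t : ℝ | 0 < 1 * t}.indicator F) volume x,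
    integral_sub_left_eq_self ({t : ℝ | 0 < -1 * t}.indicator F) volume x,
    ← integral_add (hFint.indicator (hms 1)) (hFint.indicator (hms (-1)))]
  unfold carlesonPiece
  rw [← hq, ← integral_mul_const]
  refine integral_congr_ae (Filter.Eventually.of_forall fun t => ?_)
  beta_reduce
  rcases lt_trichotomy t 0 with ht | ht | ht
  · rw [Set.indicator_of_notMem (show t ∉ {t : ℝ | 0 < 1 * t} from
        fun h : 0 < 1 * t => by linarith),
      Set.indicator_of_mem (show t ∈ {t : ℝ | 0 < -1 * t} from
        show 0 < -1 * t by linarith), zero_add]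
  · rw [Set.indicator_of_notMem (show t ∉ {t : ℝ | 0 < 1 * t} from
        fun h : 0 < 1 * t => by linarith),
      Set.indicator_of_notMem (show t ∉ {t : ℝ | 0 < -1 * t} from
        fun h : 0 < -1 * t => by linarith)]
    simp [carlesonIntegrand, dyadicDilate, ht, hρ0]
  · rw [Set.indicator_of_mem (show t ∈ {t : ℝ | 0 < 1 * t} from
        show 0 < 1 * t by linarith),
      Set.indicator_of_notMem (show t ∉ {t : ℝ | 0 < -1 * t} from
        fun h : 0 < -1 * t => by linarith), add_zero]

end Piece

lemma le_ofReal_mul_of_sq_le {u v : ENNReal} {r : ℝ} (hr : 0 ≤ r)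
    (h : u ^ 2 ≤ ENNReal.ofReal (r ^ 2) * v ^ 2) : u ≤ ENNReal.ofReal r * v := by
  rw [ENNReal.ofReal_pow hr, ← mul_pow] at h
  exact (ENNReal.pow_right_strictMono two_ne_zero).le_iff_le.1 h

theorem mainTheorem8 (d : ℕ) :
    ∃ ε : ℝ, 0 < ε ∧
      ∀ (ρ φ : ℝ → ℝ), IsDyadicKernel ρ → IsDyadicCutoff φ →
      ∀ (α s : Fin d → ℝ), (∀ k, 0 < α k ∧ α k ≠ 1 ∧ α k ≠ 2) → Function.Injective α →
        (∀ k, s k = 1 ∨ s k = -1) →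
      ∃ K : ℝ, 0 < K ∧
        ∀ (a₀ : ℝ → ℝ) (a : Fin d → ℝ → ℝ), Measurable a₀ → (∀ k, Measurable (a k)) →
        ∀ (j : ℤ) (m : ℕ) (f : ℝ → ℂ), MemLp f 2 volume →
          (∀ x, Integrable (carlesonIntegrand ρ (hybridCurve α s a₀ a) j f x) volume) ∧
          MemLp (carlesonPiece ρ φ α s a₀ a j m f) 2 volume ∧
          eLpNorm (carlesonPiece ρ φ α s a₀ a j m f) 2 volume ≤
            ENNReal.ofReal (K * (2 : ℝ) ^ (-ε * (m : ℝ))) * eLpNorm f 2 volume := by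
  set P : ℕ := 3 * (d ^ 2 + 2 * d) + 1 with hP
  have hP0 : (0 : ℝ) < P := by rw [hP]; positivity
  refine ⟨1 / (4 * P), by positivity, fun ρ φ hρ hφ α s hα hinj hs => ?_⟩
  have hψ : ∀ σ : ℝ, ContDiff ℝ 1 fun t => ρ (σ * t) := fun σ =>
    (hρ.smooth.of_le (by exact_mod_cast le_top)).comp (contDiff_const.mul contDiff_id)
  obtain ⟨K₁, hK₁, h₁⟩ := exists_kernel_majorant α hα hinj _ (hψ 1)
  obtain ⟨K₂, hK₂, h₂⟩ := exists_kernel_majorant α hα hinj _ (hψ (-1))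
  obtain ⟨C, hC0, hC⟩ := exists_abs_le_of_tsupport_subset hφ.smooth.continuous hφ.supp
  refine ⟨Real.sqrt (2 * (C * C * K₁)) + Real.sqrt (2 * (C * C * K₂)), by positivity,
    fun a₀ a h₀ h j m f hf => ⟨integrable_carlesonIntegrand hρ h₀ h j hf, ?_⟩⟩
  -- the gain `w` is the power of the size `2 ^ m` for which `2 ^ m * w ^ (2 * P) = 1`
  set w : ℝ := (2 : ℝ) ^ (-(m : ℝ) / (2 * P)) with hw
  have hw0 : 0 < w := by positivity
  have hw1 : w ≤ 1 := Real.rpow_le_one_of_one_le_of_nonpos (by norm_num)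
    (div_nonpos_of_nonpos_of_nonneg (by simp) (by positivity))
  have hN : (2 : ℝ) ^ m * w ^ (2 * P) = 1 := by
    rw [hw, ← Real.rpow_natCast (_ ^ _), ← Real.rpow_natCast, ← Real.rpow_mul (by norm_num),
      ← Real.rpow_add (by norm_num)]
    push_cast
    rw [div_mul_cancel₀ _ (by positivity), add_neg_cancel, Real.rpow_zero]
  have hwε : w = ((2 : ℝ) ^ (-(1 / (4 * P)) * (m : ℝ))) ^ 2 := by
    rw [hw, ← Real.rpow_natCast, ← Real.rpow_mul (by norm_num)]
    congr 1
    push_cast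
    field_simp
    norm_num
  have hone : ∀ (σ K : ℝ), (σ = 1 ∨ σ = -1) → 0 < K →
      (∀ (c₀ : ℝ) (c : Fin d → ℝ), 1 / 4 ≤ ∑ k, |c k| → ∑ k, |c k| ≤ 4 →
      ∃ H : ℝ → ENNReal, ∫⁻ r, H r ≤ ENNReal.ofReal (K * w) ∧
        ∀ (r b₀ : ℝ) (b : Fin d → ℝ), ∑ k, |b k| ≤ 4 →
          ‖∫ t in overlap r, Complex.exp (Complex.I * ((c₀ * t + 2 ^ m * genPoly α c 0 t -
            (b₀ * (t - r) + 2 ^ m * genPoly α b 0 (t - r)) : ℝ) : ℂ)) *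
              ((ρ (σ * t) * ρ (σ * (t - r)) : ℝ) : ℂ)‖ₑ ≤ H r) →
      MemLp (fun x => ∫ z, pieceKernel ρ φ α s a₀ a j m σ x z * f z) 2 volume ∧
      eLpNorm (fun x => ∫ z, pieceKernel ρ φ α s a₀ a j m σ x z * f z) 2 volume ≤
        ENNReal.ofReal (Real.sqrt (2 * (C * C * K)) * (2 : ℝ) ^ (-(1 / (4 * P)) * (m : ℝ))) *
          eLpNorm f 2 volume := by
    intro σ K hσ hK hB
    obtain ⟨D, hD, hD₁, hD₂⟩ := exists_schur_bound_pieceKernel (α := α) (s := s) (a₀ := a₀)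
      (a := a) hρ hC j m σ
    obtain ⟨hmem, hle⟩ := memLp_integral_kernel hD (measurable_pieceKernel hρ hφ h₀ h j m σ) hD₁
      hD₂ (lintegral_enorm_integral_pieceKernel_le hρ hφ hs hσ hC j m hB) hf
    refine ⟨hmem, le_ofReal_mul_of_sq_le (by positivity) (hle.trans (le_of_eq ?_))⟩
    congr 1
    rw [mul_pow, Real.sq_sqrt (by positivity), ← hwε, ← ENNReal.ofReal_mul (by positivity),
      ← ENNReal.ofReal_ofNat, ← ENNReal.ofReal_mul (by norm_num)]
    congr 1
    ring
  obtain ⟨hm₁, hb₁⟩ := hone 1 K₁ (Or.inl rfl) hK₁ (h₁ w _ hw0 hw1 hN)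
  obtain ⟨hm₂, hb₂⟩ := hone (-1) K₂ (Or.inr rfl) hK₂ (h₂ w _ hw0 hw1 hN)
  rw [carlesonPiece_eq_add hρ h₀ h j m hf]
  refine ⟨hm₁.add hm₂, (eLpNorm_add_le hm₁.1 hm₂.1 (by norm_num)).trans
    ((add_le_add hb₁ hb₂).trans (le_of_eq ?_))⟩
  rw [← add_mul, ← ENNReal.ofReal_add (by positivity) (by positivity), ← add_mul]
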